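/- Let $M$ be a compact connected Riemannian manifold of finite dimension $d\ge 1$ with Riemannian distance $\mathrm{dist}$, balls $B_r(x)$, and a normalised smooth volume $\mathrm{Leb}$. Let $f:M\to M$ be a measurable map which is continuous on a set $Y$ of full $\mathrm{Leb}$-measure, and suppose that some $x_0\in M$ has an orbit $\{f^n x_0:n\ge 0\}$ which is dense in $M$ and contained in $Y$. Assume that $f$ is randomly perturbed in one of the following two ways. (a) *Random maps.* $X$ is a compact metric space, $\theta$ a Borel probability measure on $X$ and $F:M\times X\to M$, $F(x,\omega)=f_\omega(x)=f^x(\omega)$, a measurable map. For some $\omega_0\in X$ and $\varepsilon_0>0$ we have $f_{\omega_0}=f$ and $\mathrm{supp}\,\theta\supset\{\omega: d(\omega,\omega_0)<\varepsilon_0\}$, and there are constants $\rho_0>0$ and $\overline q>\underline q>0$ such that for $\mathrm{Leb}$-a.e. $x$: $\mathrm{supp}\big((f^x)_*\theta\big)\supset B_{\rho_0}(f x)$ (when $f^x$ is continuous this says $f^x(\mathrm{supp}\,\theta)\supset B_{\rho_0}(fx)$), and $(f^x)_*\theta=q_x\,\mathrm{Leb}$ with $\underline q\le q_x\le\overline q$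 $\mathrm{Leb}$-a.e. on $\mathrm{supp}\big((f^x)_*\theta\big)$. Let $\mu$ be a stationary probability measure, i.e. $\iint\varphi(f_\omega(x))\,d\theta(\omega)\,d\mu(x)=\int\varphi\,d\mu$ for all $\mu$-integrable $\varphi$, and assume that $(f^x)_*\theta\ll\mathrm{Leb}$ also for $\mu$-a.e. $x$ (this is automatic if it holds for every $x$). (b) *Markov chain.* $p_x=q_x\,\mathrm{Leb}$, $x\in M$, are probability measures whose densities $q_x$ are positive, Hölder continuous (for some exponent $\alpha>0$) and vary continuously with $x\in M$ in the $C^0$ topology, and there are $\rho_0>0$, $\overline q>\underline q>0$ with $\mathrm{supp}(q_x)\supset B_{\rho_0}(fx)$ and $\underline q\le q_x\le\overline q$ for all $x\in Y$. Let $\mu$ be a stationary probability measure for $(p_x)$, i.e. $\iint\varphi\,dp_x\,d\mu(x)=\int\varphi\,d\mu$ for all $\mu$-integrable $\varphi$. The chain is represented by random maps: $(X,\theta)$ is any probability space and $F:M\times X\to M$, $F(x,\omega)=f_\omega(x)=f^x(\omega)$, any measurable map with $(f^x)_*\theta=p_x$ for all $x\in M$. Put $\Omega=X^{\mathbb N}$,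 $\mathbb P=\mu\times\theta^{\mathbb N}$ and $S:M\times\Omega\to M\times\Omega$, $S(x,\underline\omega)=(f_{\omega_1}(x),\sigma\underline\omega)$ with $\sigma$ the one-sided shift. For $A\subset M\times\Omega$ let $r_A(z)=\min\{j\ge 1: S^j z\in A\}\in\{1,2,\dots\}\cup\{\infty\}$. Then for every $\zeta\in M$ and every sequence $\delta_n>0$ with $\delta_n\to 0$, the sets $V_n=B_{\delta_n}(\zeta)\times\Omega$ satisfy $\mathbb P(V_n)>0$, $\mathbb P(V_n)\to 0$, and the system has exponential hitting and return time statistics for $(V_n)$: for all $t\ge 0$, $$\mathbb P\Big(r_{V_n}\le \frac{t}{\mathbb P(V_n)}\Big)\to 1-e^{-t},\qquad \mathbb P\Big(r_{V_n}\le \frac{t}{\mathbb P(V_n)}\,\Big|\,V_n\Big)\to 1-e^{-t}\qquad(n\to\infty).$$ In case (b) the same holds on path space, i.e. for $M^{\mathbb N}$ (times $0,1,2,\dots$) with the law of the Markov chain with initial law $\mu$ and transition probabilities $(p_x)$, the shift map, and $V_n=\{z: z_0\in B_{\delta_n}(\zeta)\}$. -/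

import Mathlib

open MeasureTheory ProbabilityTheory Set Filter Topology Manifold Bundle
open scoped ENNReal NNReal ContDiff

universe u v w

noncomputable section

/-- `Leb` is given by a smooth nowhere vanishing volume form (density) on the `d`-dimensional
manifold `M`: in every chart of the atlas it has a smooth positive density with respect to the
Lebesgue measure of `ℝ^d`. Together with `IsProbabilityMeasure Leb` this is a normalised volume
form; the normalised Riemannian volume of any smooth Riemannian metric is of this kind. -/
def IsSmoothVolume (d : ℕ) {M : Type*} [TopologicalSpace M] [MeasurableSpace M]
    [ChartedSpace (EuclideanSpace ℝ (Fin d)) M] (Leb : Measure M) : Prop :=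
  ∀ e ∈ atlas (EuclideanSpace ℝ (Fin d)) M,
    ∃ ρ : EuclideanSpace ℝ (Fin d) → ℝ,
      ContDiffOn ℝ ∞ ρ e.target ∧ (∀ y ∈ e.target, 0 < ρ y) ∧
      ∀ A : Set M, MeasurableSet A → A ⊆ e.source →
        Leb A = ∫⁻ y in e '' A, ENNReal.ofReal (ρ y)

section Statistics

variable {𝒳 : Type*} [MeasurableSpace 𝒳]

/-- The first hitting time of `A` (its restriction to `A` is the first return time):
the least `j ≥ 1` with `T^j z ∈ A`, and `∞` if there is none. -/
def hitTime (T : 𝒳 → 𝒳) (A : Set 𝒳) (z : 𝒳) : ℕ∞ :=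
  ⨅ (j : ℕ) (_ : 1 ≤ j ∧ T^[j] z ∈ A), (j : ℕ∞)

/-- The rare event `{r_A ≤ t / ℙ(A)}`. -/
def hitEvent (P : Measure 𝒳) (T : 𝒳 → 𝒳) (A : Set 𝒳) (t : ℝ) : Set 𝒳 :=
  {z | (hitTime T A z : ℝ≥0∞) ≤ ENNReal.ofReal t / P A}

/-- The sets `V n` are measurable, of positive measure, and their measures tend to `0`. -/
structure IsRareSequence (P : Measure 𝒳) (V : ℕ → Set 𝒳) : Prop where
  measurable : ∀ n, MeasurableSet (V n)
  pos : ∀ n, 0 < P (V n)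
  tendsto_zero : Tendsto (fun n => P (V n)) atTop (𝓝 0)

/-- The system `(𝒳, P, T)` has Hitting Time Statistics `G` for `(V n)`. -/
def HasHTS (P : Measure 𝒳) (T : 𝒳 → 𝒳) (V : ℕ → Set 𝒳) (G : ℝ → ℝ) : Prop :=
  IsRareSequence P V ∧
  ∀ t : ℝ, 0 ≤ t → Tendsto (fun n => P.real (hitEvent P T (V n) t)) atTop (𝓝 (G t))

/-- The system `(𝒳, P, T)` has Return Time Statistics `G` for `(V n)`; here `P[|V n]` is the
conditional probability given `V n`. -/
def HasRTS (P : Measure 𝒳) (T : 𝒳 → 𝒳) (V : ℕ → Set 𝒳) (G : ℝ → ℝ) : Prop :=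
  IsRareSequence P V ∧
  ∀ t : ℝ, 0 ≤ t → Tendsto (fun n => (P[|V n]).real (hitEvent P T (V n) t)) atTop (𝓝 (G t))

/-- Exponential hitting and return time statistics: `G(t) = G̃(t) = 1 - e^{-t}`. -/
def HasExponentialHTSRTS (P : Measure 𝒳) (T : 𝒳 → 𝒳) (V : ℕ → Set 𝒳) : Prop :=
  HasHTS P T V (fun t => 1 - Real.exp (-t)) ∧ HasRTS P T V (fun t => 1 - Real.exp (-t))

end Statistics

section RandomMaps

variable {M : Type*} [MeasurableSpace M]

/-- The probability measure `μ` is stationary for the transition probabilities `p`: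
`∫∫ φ(y) dp_x(y) dμ(x) = ∫ φ dμ` for all `μ`-integrable `φ`. -/
def IsStationaryMeasure (p : M → Measure M) (μ : Measure M) : Prop :=
  ∀ φ : M → ℝ, Integrable φ μ → ∫ x, ∫ y, φ y ∂(p x) ∂μ = ∫ x, φ x ∂μ

variable {X : Type*} [MeasurableSpace X]

/-- The transition probabilities `p_x = (f^x)_* θ` of the random maps `f_ω = F(·, ω)`, where
`f^x(ω) = F(x, ω)` and `ω` has law `θ`. -/
def transition (F : M → X → M) (θ : Measure X) (x : M) : Measure M :=
  θ.map (F x)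

/-- The skew product `S(x, ω) = (f_{ω₁}(x), σ ω)` on `M × X^ℕ`, with `σ` the shift. -/
def skewProduct (F : M → X → M) (z : M × (ℕ → X)) : M × (ℕ → X) :=
  (F z.1 (z.2 0), fun n => z.2 (n + 1))

/-- The measure `μ × θ^ℕ` on `M × X^ℕ`. -/
def annealed (μ : Measure M) (θ : Measure X) : Measure (M × (ℕ → X)) :=
  μ.prod (Measure.infinitePi fun _ : ℕ => θ)

end RandomMaps

/-- `(f_ω, θ)` is a uniformly continuous random perturbation of `f`:
for some `ω₀` and `ε₀ > 0` one has `supp θ ⊇ V_{ε₀}(ω₀)` and `f_{ω₀} = f`, and there are constants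
`ρ₀ > 0` and `qhi > qlo > 0` such that for `Leb`-a.e. `x` the law `(f^x)_* θ` of the perturbed image
of `x` charges every part of the ball `B_{ρ₀}(f x)`, i.e. its support contains that ball, and
`(f^x)_* θ = q_x Leb` with `qlo ≤ q_x ≤ qhi` `Leb`-a.e. on the support of `(f^x)_* θ`.
If `f^x` is continuous on the compact parameter space, then the support of `(f^x)_* θ`
is `f^x (supp θ)`. -/
def IsUniformRandomPerturbation {M : Type*} [MetricSpace M] [MeasurableSpace M]
    {X : Type*} [MetricSpace X] [MeasurableSpace X]
    (Leb : Measure M) (f : M → M) (F : M → X → M) (θ : Measure X) : Prop :=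
  (∃ (ω₀ : X) (ε₀ : ℝ), 0 < ε₀ ∧ Metric.ball ω₀ ε₀ ⊆ θ.support ∧ ∀ x, F x ω₀ = f x) ∧
  (∃ ρ₀ : ℝ, 0 < ρ₀ ∧
    ∀ᵐ x ∂Leb, Metric.ball (f x) ρ₀ ⊆ (transition F θ x).support) ∧
  ∃ qlo qhi : ℝ≥0, 0 < qlo ∧ qlo < qhi ∧
    ∀ᵐ x ∂Leb, ∃ q : M → ℝ≥0, Measurable q ∧
      transition F θ x = Leb.withDensity (fun y => (q y : ℝ≥0∞)) ∧
      ∀ᵐ y ∂Leb, y ∈ (transition F θ x).support → qlo ≤ q y ∧ q y ≤ qhi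

section MarkovChains

variable {M : Type*} [MeasurableSpace M]

/-- The measure `p_x = q_x Leb`. -/
def densityKernel [TopologicalSpace M] (Leb : Measure M) (q : M → C(M, ℝ)) (x : M) : Measure M :=
  Leb.withDensity (fun y => ENNReal.ofReal (q x y))

/-- The transition probabilities `p_x = q_x Leb` have positive Hölder continuous
probability densities `q_x`, which depend continuously on `x` in the `C⁰` topology, and there are
`ρ₀ > 0` and `qhi > qlo > 0` with `supp q_x ⊇ B_{ρ₀}(f x)` and `qlo ≤ q_x ≤ qhi` for `x ∈ Y`. -/
structure IsRegularMarkovPerturbation [MetricSpace M]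
    (Leb : Measure M) (f : M → M) (Y : Set M) (q : M → C(M, ℝ)) : Prop where
  pos : ∀ x y, 0 < q x y
  isProbability : ∀ x, IsProbabilityMeasure (densityKernel Leb q x)
  holder : ∀ x, ∃ C α : ℝ≥0, 0 < α ∧ HolderWith C α (q x)
  continuous : Continuous q
  cover : ∃ ρ₀ : ℝ, 0 < ρ₀ ∧ ∀ x ∈ Y, Metric.ball (f x) ρ₀ ⊆ tsupport (q x)
  bounds : ∃ qlo qhi : ℝ, 0 < qlo ∧ qlo < qhi ∧ ∀ x ∈ Y, ∀ y, qlo ≤ q x y ∧ q x y ≤ qhi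

/-- `P` is the law on path space `M^ℕ` of the Markov chain with initial law `μ` and transition
probabilities `p`. -/
structure IsMarkovChainLaw (p : M → Measure M) (μ : Measure M) (P : Measure (ℕ → M)) : Prop where
  init : P.map (fun z => z 0) = μ
  step : ∀ (n : ℕ) (A : Set (Fin (n + 1) → M)) (B : Set M), MeasurableSet A → MeasurableSet B →
    P {z | (fun i : Fin (n + 1) => z i) ∈ A ∧ z (n + 1) ∈ B} =
      ∫⁻ z in {z | (fun i : Fin (n + 1) => z i) ∈ A}, p (z n) B ∂P

/-- The one-sided shift on path space. -/
def pathShift (z : ℕ → M) : ℕ → M := fun n => z (n + 1)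

end MarkovChains

end

/-! Write `p` for the probability of `V n`, `a m` for the probability of no visit at times `1, …,
m`, and `b m` for the same probability conditioned on starting in `V n`. Stationarity gives `a (m +
1) = a m - p * b m`. If `|b m - a m| ≤ e` for all `m`, then `|a m - (1 - p) ^ m| ≤ e`, and `(1 - p)
^ ⌊t / p⌋ → exp (-t)`; this yields both limit laws at once (`hasExponentialHTSRTS_of_survival`).

The closeness of `a` and `b`, uniform in `m`, comes from two properties of the transition kernel,
collected in `IsDoeblinKernel`. A Doeblin minorization gives a time `s`, depending only on the
error, after which the chain has forgotten its starting point. The upper bound `C` on the densities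
makes a visit to the target `B` during those `s` steps have probability at most `s * C * Leb B`,
which vanishes as `B` shrinks (`kernelOp_avoidProb_close`).

For the Markov chain the minorization follows by compactness, the densities being positive. For
random maps one follows the dense orbit `z i`: one step from near `z i` spreads mass over a ball of
fixed radius around its image, so small balls around successive orbit points are linked, and density
of the orbit leads back to `z 0`. The possible return times have gcd one because `M` is connected,
so every large time is a return time, and a finite subcover makes the time uniform in the starting
point (`exists_reaches_of_dense_orbit`). The same argument shows that the stationary measure charges
every ball. -/

noncomputable section

/-! ### Exponential statistics from nearly independent survival probabilities -/

section Statistics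

variable {𝒳 : Type*} [MeasurableSpace 𝒳]

/-- The set of points whose orbit does not meet `A` at the times `1, …, m`. -/
def survivalSet (T : 𝒳 → 𝒳) (A : Set 𝒳) (m : ℕ) : Set 𝒳 :=
  {z | ∀ j, 1 ≤ j → j ≤ m → T^[j] z ∉ A}

/-- Hitting times are integers or infinite, so the real threshold may be replaced by its floor. -/
theorem hitEvent_eq_compl_survivalSet {P : Measure 𝒳} [IsFiniteMeasure P] (T : 𝒳 → 𝒳)
    {A : Set 𝒳} (hA : P A ≠ 0) {t : ℝ} (ht : 0 ≤ t) :
    hitEvent P T A t = (survivalSet T A ⌊t / P.real A⌋₊)ᶜ := by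
  have hp : 0 < P.real A := ENNReal.toReal_pos hA (measure_ne_top P A)
  have hx : ENNReal.ofReal t / P A = ENNReal.ofReal (t / P.real A) := by
    rw [ENNReal.ofReal_div_of_pos hp, ofReal_measureReal]
  ext z
  simp only [hitEvent, hx, mem_ofPred_eq, mem_compl_iff, survivalSet]
  constructor
  · intro h hz
    have h1 : ((⌊t / P.real A⌋₊ + 1 : ℕ) : ℕ∞) ≤ hitTime T A z := by
      refine le_iInf₂ fun j hj => ?_
      by_contra hlt
      have : j < ⌊t / P.real A⌋₊ + 1 := by exact_mod_cast not_le.1 hlt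
      exact hz j hj.1 (by omega) hj.2
    have h2 : ((⌊t / P.real A⌋₊ + 1 : ℕ) : ℝ≥0∞) ≤ ENNReal.ofReal (t / P.real A) :=
      le_trans (by exact_mod_cast ENat.toENNReal_mono h1) h
    rw [← ENNReal.ofReal_natCast, ENNReal.ofReal_le_ofReal_iff (by positivity)] at h2
    have := Nat.lt_floor_add_one (t / P.real A)
    push_cast at h2
    linarith
  · intro h
    push Not at h
    obtain ⟨j, hj1, hj2, hj3⟩ := h
    have h1 : hitTime T A z ≤ (j : ℕ∞) := iInf₂_le j ⟨hj1, hj3⟩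
    have h2 : (hitTime T A z : ℝ≥0∞) ≤ (j : ℝ≥0∞) := by
      exact_mod_cast ENat.toENNReal_mono h1
    refine h2.trans ?_
    rw [← ENNReal.ofReal_natCast]
    refine ENNReal.ofReal_le_ofReal ?_
    exact (Nat.le_floor_iff (by positivity)).1 hj2

/-- The error obeys `a (m+1) - (1-p)^(m+1) = (1-p) * (a m - (1-p)^m) - p * (b m - a m)`. The weights
`1-p` and `p` sum to one, so errors do not accumulate with `m`. -/
theorem abs_sub_pow_le_of_recursion {a b : ℕ → ℝ} {p e : ℝ} (hp0 : 0 ≤ p) (hp1 : p ≤ 1)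
    (h0 : a 0 = 1) (hrec : ∀ m, a (m + 1) = a m - p * b m) (he : 0 ≤ e)
    (hb : ∀ m, |b m - a m| ≤ e) (m : ℕ) : |a m - (1 - p) ^ m| ≤ e := by
  induction m with
  | zero => simpa [h0] using he
  | succ m ih =>
    rw [hrec, pow_succ]
    have h1 := abs_le.1 ih
    have h2 := abs_le.1 (hb m)
    rw [abs_le]
    constructor
    · nlinarith
    · nlinarith

/-- Take logarithms once `p n < 1`: `⌊t / p⌋ * p → t` and `log (1 - p) / p → -1`. -/
theorem tendsto_one_sub_pow_floor {p : ℕ → ℝ} (hp : ∀ n, 0 < p n) (h0 : Tendsto p atTop (𝓝 0))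
    {t : ℝ} (ht : 0 ≤ t) :
    Tendsto (fun n => (1 - p n) ^ ⌊t / p n⌋₊) atTop (𝓝 (Real.exp (-t))) := by
  have hlog : Tendsto (fun n => Real.log (1 - p n) / p n) atTop (𝓝 (-1)) := by
    have hd : HasDerivAt (fun x : ℝ => Real.log (1 - x)) (-1) 0 := by
      have := ((hasDerivAt_id (0 : ℝ)).const_sub 1).log (by simp)
      simpa using this
    have h1 := hd.tendsto_slope_zero
    have h2 : Tendsto p atTop (𝓝[≠] 0) :=
      tendsto_nhdsWithin_iff.2 ⟨h0, Eventually.of_forall fun n => (hp n).ne'⟩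
    refine (h1.comp h2).congr fun n => ?_
    simp [div_eq_inv_mul]
  have hfl : Tendsto (fun n => (⌊t / p n⌋₊ : ℝ) * p n) atTop (𝓝 t) := by
    have hl : Tendsto (fun n => t - p n) atTop (𝓝 t) := by simpa using h0.const_sub t
    refine tendsto_of_tendsto_of_tendsto_of_le_of_le hl tendsto_const_nhds (fun n => ?_) fun n => ?_
    · have h1 := (Nat.lt_floor_add_one (t / p n)).le
      have h2 : t ≤ (⌊t / p n⌋₊ + 1) * p n := (div_le_iff₀ (hp n)).1 h1
      simp only
      linarith
    · have h1 := Nat.floor_le (div_nonneg ht (hp n).le)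
      exact (le_div_iff₀ (hp n)).1 h1
  have hm := (Real.continuous_exp.tendsto _).comp (hfl.mul hlog)
  simp only [mul_neg, mul_one] at hm
  refine hm.congr' ?_
  filter_upwards [h0.eventually (gt_mem_nhds one_pos)] with n hn
  have hn' := (hp n).ne'
  have h1 : (⌊t / p n⌋₊ : ℝ) * p n * (Real.log (1 - p n) / p n)
      = ⌊t / p n⌋₊ * Real.log (1 - p n) := by field_simp
  simp only [Function.comp_apply, h1]
  rw [mul_comm, Real.exp_mul, Real.exp_log (by linarith), Real.rpow_natCast]

/-- If the conditional survival probabilities given `V n` are uniformly close to the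
unconditional ones, the hitting and return time statistics are exponential. -/
theorem hasExponentialHTSRTS_of_survival {P : Measure 𝒳} [IsProbabilityMeasure P] {T : 𝒳 → 𝒳}
    {V : ℕ → Set 𝒳} (hV : IsRareSequence P V)
    (hmeas : ∀ n m, MeasurableSet (survivalSet T (V n) m))
    (hrec : ∀ n m, P.real (survivalSet T (V n) (m + 1)) =
      P.real (survivalSet T (V n) m) - P.real (V n ∩ survivalSet T (V n) m))
    (hdec : ∀ e : ℝ, 0 < e → ∀ᶠ n in atTop, ∀ m,
      |P.real (V n ∩ survivalSet T (V n) m) - P.real (V n) * P.real (survivalSet T (V n) m)|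
        ≤ e * P.real (V n)) :
    HasExponentialHTSRTS P T V := by
  have hp : ∀ n, 0 < P.real (V n) := fun n => 
    ENNReal.toReal_pos (hV.pos n).ne' (measure_ne_top P _)
  have hp0 : Tendsto (fun n => P.real (V n)) atTop (𝓝 0) := by
    have := (ENNReal.tendsto_toReal ENNReal.zero_ne_top).comp hV.tendsto_zero
    simpa [Measure.real, Function.comp_def] using this
  have hcond : ∀ n m, (P[|V n]).real (survivalSet T (V n) m) =
      P.real (V n ∩ survivalSet T (V n) m) / P.real (V n) := by
    intro n m
    rw [measureReal_def, cond_apply (hV.measurable n), ENNReal.toReal_mul, ENNReal.toReal_inv,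
      measureReal_def, measureReal_def, div_eq_inv_mul]
  have hclose : ∀ e : ℝ, 0 < e → ∀ᶠ n in atTop, ∀ m,
      |(P[|V n]).real (survivalSet T (V n) m) - P.real (survivalSet T (V n) m)| ≤ e ∧
      |P.real (survivalSet T (V n) m) - (1 - P.real (V n)) ^ m| ≤ e := by
    intro e he
    filter_upwards [hdec e he] with n hn
    have h1 : ∀ m, |(P[|V n]).real (survivalSet T (V n) m)
        - P.real (survivalSet T (V n) m)| ≤ e := by
      intro m
      have h2 := hn m
      have h3 : P.real (V n ∩ survivalSet T (V n) m)
          - P.real (V n) * P.real (survivalSet T (V n) m) =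
          ((P[|V n]).real (survivalSet T (V n) m) - P.real (survivalSet T (V n) m))
            * P.real (V n) := by
        rw [hcond]
        have := (hp n).ne'
        field_simp
      rw [h3, abs_mul, abs_of_pos (hp n)] at h2
      exact le_of_mul_le_mul_right h2 (hp n)
    refine fun m => ⟨h1 m, ?_⟩
    refine abs_sub_pow_le_of_recursion (hp n).le measureReal_le_one ?_ (fun m => ?_) he.le h1 m
    · have : survivalSet T (V n) 0 = univ := by
        ext z
        simp only [survivalSet, mem_ofPred_eq, mem_univ, iff_true]
        omega
      simp [this]
    · rw [hrec, hcond]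
      have := (hp n).ne'
      field_simp
  have hsurv : ∀ t : ℝ, 0 ≤ t →
      Tendsto (fun n => P.real (survivalSet T (V n) ⌊t / P.real (V n)⌋₊)) atTop
        (𝓝 (Real.exp (-t))) := by
    intro t ht
    have h1 : Tendsto (fun n => P.real (survivalSet T (V n) ⌊t / P.real (V n)⌋₊) -
        (1 - P.real (V n)) ^ ⌊t / P.real (V n)⌋₊) atTop (𝓝 0) := by
      rw [Metric.tendsto_nhds]
      intro e he
      filter_upwards [hclose (e / 2) (by positivity)] with n hn
      simpa using (hn _).2.trans_lt (by linarith)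
    simpa using h1.add (tendsto_one_sub_pow_floor hp hp0 ht)
  refine ⟨⟨hV, fun t ht => ?_⟩, hV, fun t ht => ?_⟩
  · have h1 : ∀ n, P.real (hitEvent P T (V n) t) =
        1 - P.real (survivalSet T (V n) ⌊t / P.real (V n)⌋₊) := fun n => by
      rw [hitEvent_eq_compl_survivalSet T (hV.pos n).ne' ht, probReal_compl_eq_one_sub (hmeas _ _)]
    simp only [h1]
    exact (hsurv t ht).const_sub 1
  · have h1 : ∀ n, (P[|V n]).real (hitEvent P T (V n) t) =
        1 - (P[|V n]).real (survivalSet T (V n) ⌊t / P.real (V n)⌋₊) := fun n => by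
      have := cond_isProbabilityMeasure (hV.pos n).ne'
      rw [hitEvent_eq_compl_survivalSet T (hV.pos n).ne' ht, probReal_compl_eq_one_sub (hmeas _ _)]
    simp only [h1]
    have h2 : Tendsto (fun n => (P[|V n]).real (survivalSet T (V n) ⌊t / P.real (V n)⌋₊) -
        P.real (survivalSet T (V n) ⌊t / P.real (V n)⌋₊)) atTop (𝓝 0) := by
      rw [Metric.tendsto_nhds]
      intro e he
      filter_upwards [hclose (e / 2) (by positivity)] with n hn
      simpa using (hn _).1.trans_lt (by linarith)
    simpa using (h2.add (hsurv t ht)).const_sub 1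

end Statistics

/-! ### Doeblin contraction and loss of memory for avoidance probabilities -/

section TransferOperator

variable {M : Type*} [MeasurableSpace M] (κ : Kernel M M)

/-- The operator `φ ↦ ∫ φ dκ_x` of the kernel `κ` on nonnegative functions. -/
def kernelOp (φ : M → ℝ≥0∞) (x : M) : ℝ≥0∞ := ∫⁻ y, φ y ∂κ x

theorem measurable_kernelOp {φ : M → ℝ≥0∞} (hφ : Measurable φ) : Measurable (kernelOp κ φ) :=
  hφ.lintegral_kernel

theorem measurable_kernelOp_iterate {φ : M → ℝ≥0∞} (hφ : Measurable φ) (k : ℕ) :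
    Measurable ((kernelOp κ)^[k] φ) := by
  induction k with
  | zero => exact hφ
  | succ k ih => rw [Function.iterate_succ_apply']; exact measurable_kernelOp κ ih

theorem kernelOp_mono {φ ψ : M → ℝ≥0∞} (h : φ ≤ ψ) : kernelOp κ φ ≤ kernelOp κ ψ :=
  fun _ => lintegral_mono h

theorem kernelOp_iterate_add {φ ψ : M → ℝ≥0∞} (hφ : Measurable φ) (k : ℕ) :
    (kernelOp κ)^[k] (φ + ψ) = (kernelOp κ)^[k] φ + (kernelOp κ)^[k] ψ := by
  induction k with
  | zero => rfl
  | succ k ih =>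
    simp only [Function.iterate_succ_apply', ih]
    ext x
    exact lintegral_add_left (measurable_kernelOp_iterate κ hφ k) _

theorem kernelOp_iterate_const [IsMarkovKernel κ] (c : ℝ≥0∞) (k : ℕ) :
    (kernelOp κ)^[k] (fun _ => c) = fun _ => c := by
  induction k with
  | zero => rfl
  | succ k ih =>
    rw [Function.iterate_succ_apply', ih]
    ext x
    simp [kernelOp]

/-- The probability of avoiding `B` at the times `0, …, m - 1`, as a function of the initial
point. -/
def avoidProb (B : Set M) : ℕ → M → ℝ≥0∞
  | 0 => fun _ => 1
  | m + 1 => Bᶜ.indicator (kernelOp κ (avoidProb B m))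

variable {B : Set M}

theorem measurable_avoidProb (hB : MeasurableSet B) (m : ℕ) : Measurable (avoidProb κ B m) := by
  induction m with
  | zero => exact measurable_const
  | succ m ih => exact (measurable_kernelOp κ ih).indicator hB.compl

theorem avoidProb_le_one [IsMarkovKernel κ] (B : Set M) (m : ℕ) :
    avoidProb κ B m ≤ fun _ => 1 := by
  induction m with
  | zero => exact le_rfl
  | succ m ih =>
    refine (indicator_le_self _ _).trans ((kernelOp_mono κ ih).trans (le_of_eq ?_))
    exact kernelOp_iterate_const κ 1 1

/-- Avoidance up to time `s + m` implies avoidance from time `s` on. -/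
theorem avoidProb_add_le (B : Set M) (s m : ℕ) :
    avoidProb κ B (s + m) ≤ (kernelOp κ)^[s] (avoidProb κ B m) := by
  induction s with
  | zero => simp
  | succ s ih =>
    rw [Nat.add_right_comm, Function.iterate_succ_apply']
    exact (indicator_le_self _ _).trans (kernelOp_mono κ ih)

/-- Avoidance from time `s` on fails to give avoidance up to time `s + m` only by a visit before
time `s`. -/
theorem kernelOp_iterate_avoidProb_le [IsMarkovKernel κ] (hB : MeasurableSet B) (s m : ℕ) :
    (kernelOp κ)^[s] (avoidProb κ B m) ≤
      avoidProb κ B (s + m) + ∑ i ∈ Finset.range s, (kernelOp κ)^[i] (B.indicator 1) := by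
  induction s with
  | zero => simp
  | succ s ih =>
    have h1 : kernelOp κ (avoidProb κ B (s + m) +
        ∑ i ∈ Finset.range s, (kernelOp κ)^[i] (B.indicator 1)) =
        kernelOp κ (avoidProb κ B (s + m)) +
        ∑ i ∈ Finset.range s, (kernelOp κ)^[i + 1] (B.indicator 1) := by
      ext x
      simp only [kernelOp, Pi.add_apply, Finset.sum_apply, Function.iterate_succ_apply']
      rw [lintegral_add_left (measurable_avoidProb κ hB _), lintegral_finsetSum]
      exact fun i _ => measurable_kernelOp_iterate κ (measurable_const.indicator hB) i
    -- Off `B` this is the recursion for `avoidProb`; on `B` the indicator alone covers the left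
    -- side, which is at most `1`.
    have h2 : kernelOp κ (avoidProb κ B (s + m)) ≤
        avoidProb κ B (s + m + 1) + B.indicator 1 := by
      intro x
      by_cases hx : x ∈ B
      · have h3 : kernelOp κ (avoidProb κ B (s + m)) x ≤ 1 :=
          (kernelOp_mono κ (avoidProb_le_one κ B _) x).trans
            (le_of_eq (congrFun (kernelOp_iterate_const κ 1 1) x))
        exact h3.trans (by simp [hx])
      · simp [avoidProb, hx]
    rw [Function.iterate_succ_apply', Finset.sum_range_succ', Nat.add_right_comm]
    refine (kernelOp_mono κ ih).trans ?_
    rw [h1]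
    refine (add_le_add_left h2 _).trans (le_of_eq ?_)
    simp only [Function.iterate_zero_apply]
    ring

variable {κ} {Leb μ : Measure M}

/-- The kernel is controlled only for `Leb`-almost every point; absolute continuity lets
almost-everywhere estimates pass through the operator. -/
theorem kernelOp_mono_ae (hac : ∀ᵐ x ∂Leb, κ x ≪ Leb) {φ ψ : M → ℝ≥0∞} (h : φ ≤ᵐ[Leb] ψ) :
    kernelOp κ φ ≤ᵐ[Leb] kernelOp κ ψ := by
  filter_upwards [hac] with x hx
  exact lintegral_mono_ae (hx.ae_le h)

theorem kernelOp_iterate_mono_ae (hac : ∀ᵐ x ∂Leb, κ x ≪ Leb) {φ ψ : M → ℝ≥0∞}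
    (h : φ ≤ᵐ[Leb] ψ) (k : ℕ) : (kernelOp κ)^[k] φ ≤ᵐ[Leb] (kernelOp κ)^[k] ψ := by
  induction k with
  | zero => exact h
  | succ k ih => simp only [Function.iterate_succ_apply']; exact kernelOp_mono_ae hac ih

theorem lintegral_kernelOp_iterate
    (hstat : ∀ φ : M → ℝ≥0∞, Measurable φ → ∫⁻ x, kernelOp κ φ x ∂μ = ∫⁻ x, φ x ∂μ)
    {φ : M → ℝ≥0∞} (hφ : Measurable φ) (k : ℕ) :
    ∫⁻ x, (kernelOp κ)^[k] φ x ∂μ = ∫⁻ x, φ x ∂μ := by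
  induction k with
  | zero => rfl
  | succ k ih =>
    rw [Function.iterate_succ_apply', hstat _ (measurable_kernelOp_iterate κ hφ k), ih]

/-- Densities bounded by `C` give visits to `B` at positive times probability at most `C Leb B`. -/
theorem kernelOp_iterate_indicator_le [IsMarkovKernel κ] {C : ℝ≥0∞}
    (hC : ∀ᵐ x ∂Leb, κ x ≤ C • Leb) (hac : ∀ᵐ x ∂Leb, κ x ≪ Leb) (hB : MeasurableSet B) (i : ℕ) :
    (kernelOp κ)^[i + 1] (B.indicator 1) ≤ᵐ[Leb] fun _ => C * Leb B := by
  induction i with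
  | zero =>
    filter_upwards [hC] with x hx
    simp only [zero_add, Function.iterate_one, kernelOp, lintegral_indicator_one hB]
    exact hx B
  | succ i ih =>
    rw [Function.iterate_succ_apply']
    exact (kernelOp_mono_ae hac ih).trans
      (EventuallyEq.of_eq (kernelOp_iterate_const κ (C * Leb B) 1)).le

theorem measure_le_of_stationary
    (hstat : ∀ φ : M → ℝ≥0∞, Measurable φ → ∫⁻ x, kernelOp κ φ x ∂μ = ∫⁻ x, φ x ∂μ)
    [IsProbabilityMeasure μ] (hμ : μ ≪ Leb) {C : ℝ≥0∞}
    (hC : ∀ᵐ x ∂Leb, κ x ≤ C • Leb) (hB : MeasurableSet B) : μ B ≤ C * Leb B := by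
  rw [← lintegral_indicator_one hB, ← hstat _ (measurable_one.indicator hB)]
  calc ∫⁻ x, kernelOp κ (B.indicator 1) x ∂μ ≤ ∫⁻ _, C * Leb B ∂μ := by
        refine lintegral_mono_ae (hμ.ae_le ?_)
        filter_upwards [hC] with x hx
        simp only [kernelOp, lintegral_indicator_one hB]
        exact hx B
    _ = C * Leb B := by simp

/-- Doeblin contraction: if the `N`-step transition probabilities dominate `ν`, the `N`-th iterate
contracts oscillations by the factor `1 - ν(M)`. -/
theorem exists_oscillation_le_of_minorization [IsMarkovKernel κ]
    (hac : ∀ᵐ x ∂Leb, κ x ≪ Leb) {N : ℕ} {ν : Measure M} (hν1 : ν univ ≤ 1) (hν : ν ≪ Leb)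
    (hD : ∀ φ : M → ℝ≥0∞, Measurable φ → ∀ᵐ x ∂Leb, ∫⁻ y, φ y ∂ν ≤ (kernelOp κ)^[N] φ x)
    {φ : M → ℝ≥0∞} (hφ : Measurable φ) {a D : ℝ≥0∞} (ha : a ≠ ⊤) (hDtop : D ≠ ⊤)
    (h1 : (fun _ => a) ≤ᵐ[Leb] φ) (h2 : φ ≤ᵐ[Leb] fun _ => a + D) :
    ∃ a' : ℝ≥0∞, a' ≠ ⊤ ∧ (fun _ => a') ≤ᵐ[Leb] (kernelOp κ)^[N] φ ∧
      (kernelOp κ)^[N] φ ≤ᵐ[Leb] fun _ => a' + (1 - ν univ) * D := by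
  -- The distances of `φ` to the two ends of `[a, a + D]` sum to `D`. Minorization raises the lower
  -- end by `∫ ψ₁ dν` and lowers the upper end by `∫ ψ₂ dν`, in total `ν(M) * D`.
  set ψ₁ : M → ℝ≥0∞ := fun x => φ x - a with hψ₁
  set ψ₂ : M → ℝ≥0∞ := fun x => a + D - φ x with hψ₂
  have m1 : Measurable ψ₁ := hφ.sub_const a
  have m2 : Measurable ψ₂ := hφ.const_sub (a + D)
  have hν2 : ν univ ≠ ⊤ := (hν1.trans_lt ENNReal.one_lt_top).ne
  have hsum : ∫⁻ y, ψ₁ y ∂ν + ∫⁻ y, ψ₂ y ∂ν = ν univ * D := by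
    rw [← lintegral_add_left m1, mul_comm, ← lintegral_const]
    refine lintegral_congr_ae (hν.ae_eq ?_)
    filter_upwards [h1, h2] with x hx1 hx2
    simp only [hψ₁, hψ₂]
    rw [← ENNReal.add_right_inj ha, ← add_assoc, add_tsub_cancel_of_le hx1,
      add_tsub_cancel_of_le hx2]
  have hI1 : ∫⁻ y, ψ₁ y ∂ν ≠ ⊤ := by
    refine ne_top_of_le_ne_top (ENNReal.mul_ne_top hν2 hDtop) (le_of_le_of_eq le_self_add hsum)
  have hI2 : ∫⁻ y, ψ₂ y ∂ν ≠ ⊤ := by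
    refine ne_top_of_le_ne_top (ENNReal.mul_ne_top hν2 hDtop) (le_of_le_of_eq le_add_self hsum)
  have e1 : (fun _ => a) + ψ₁ ≤ᵐ[Leb] φ := by
    filter_upwards [h1] with x hx1
    exact (add_tsub_cancel_of_le hx1).le
  have e2 : φ + ψ₂ ≤ᵐ[Leb] fun _ => a + D := by
    filter_upwards [h2] with x hx2
    exact (add_tsub_cancel_of_le hx2).le
  refine ⟨a + ∫⁻ y, ψ₁ y ∂ν, ENNReal.add_ne_top.2 ⟨ha, hI1⟩, ?_, ?_⟩
  · filter_upwards [hD ψ₁ m1, kernelOp_iterate_mono_ae hac e1 N] with x hx1 hx2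
    rw [kernelOp_iterate_add κ measurable_const, kernelOp_iterate_const] at hx2
    exact (add_le_add_right hx1 a).trans hx2
  · filter_upwards [hD ψ₂ m2, kernelOp_iterate_mono_ae hac e2 N] with x hx1 hx2
    rw [kernelOp_iterate_add κ hφ, kernelOp_iterate_const] at hx2
    have h3 : (kernelOp κ)^[N] φ x + ∫⁻ y, ψ₂ y ∂ν ≤ a + D := (add_le_add_right hx1 _).trans hx2
    rw [← ENNReal.add_le_add_iff_right hI2]
    refine h3.trans (le_of_eq ?_)
    calc a + D = a + (ν univ + (1 - ν univ)) * D := by rw [add_tsub_cancel_of_le hν1, one_mul]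
      _ = a + (∫⁻ y, ψ₁ y ∂ν + ∫⁻ y, ψ₂ y ∂ν) + (1 - ν univ) * D := by rw [hsum]; ring
      _ = _ := by ring

/-- Uniform mixing from a Doeblin minorization. -/
theorem exists_uniform_mixing_of_minorization [IsMarkovKernel κ] [IsProbabilityMeasure μ]
    (hstat : ∀ φ : M → ℝ≥0∞, Measurable φ → ∫⁻ x, kernelOp κ φ x ∂μ = ∫⁻ x, φ x ∂μ)
    (hμ : μ ≪ Leb) (hac : ∀ᵐ x ∂Leb, κ x ≪ Leb) {N : ℕ} {ν : Measure M} (hν0 : ν univ ≠ 0)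
    (hν1 : ν univ ≤ 1) (hν : ν ≪ Leb)
    (hD : ∀ φ : M → ℝ≥0∞, Measurable φ → ∀ᵐ x ∂Leb, ∫⁻ y, φ y ∂ν ≤ (kernelOp κ)^[N] φ x)
    {e : ℝ≥0∞} (he : e ≠ 0) :
    ∃ s : ℕ, ∀ φ : M → ℝ≥0∞, Measurable φ → (φ ≤ fun _ => 1) → ∀ᵐ x ∂Leb,
      (kernelOp κ)^[s] φ x ≤ ∫⁻ y, φ y ∂μ + e ∧ ∫⁻ y, φ y ∂μ ≤ (kernelOp κ)^[s] φ x + e := by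
  have hlt : 1 - ν univ < 1 := ENNReal.sub_lt_self ENNReal.one_ne_top one_ne_zero hν0
  obtain ⟨k, hk⟩ : ∃ k : ℕ, (1 - ν univ) ^ k < e :=
    ((ENNReal.tendsto_pow_atTop_nhds_zero_of_lt_one hlt).eventually
      (gt_mem_nhds (pos_iff_ne_zero.2 he))).exists
  refine ⟨N * k, fun φ hφ hφ1 => ?_⟩
  have hosc : ∀ k : ℕ, ∃ a : ℝ≥0∞, a ≠ ⊤ ∧ (fun _ => a) ≤ᵐ[Leb] (kernelOp κ)^[N * k] φ ∧
      (kernelOp κ)^[N * k] φ ≤ᵐ[Leb] fun _ => a + (1 - ν univ) ^ k := by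
    intro k
    induction k with
    | zero =>
      exact ⟨0, ENNReal.zero_ne_top, Eventually.of_forall fun x => zero_le,
        Eventually.of_forall fun x => by simpa using hφ1 x⟩
    | succ k ih =>
      obtain ⟨a, ha, h1, h2⟩ := ih
      obtain ⟨a', ha', h1', h2'⟩ := exists_oscillation_le_of_minorization hac hν1 hν hD
        (measurable_kernelOp_iterate κ hφ _) ha
        (ENNReal.pow_ne_top (ne_top_of_lt hlt)) h1 h2
      refine ⟨a', ha', ?_, ?_⟩
      · rwa [Nat.mul_succ, Nat.add_comm, Function.iterate_add_apply]
      · rwa [Nat.mul_succ, Nat.add_comm, Function.iterate_add_apply, pow_succ']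
  obtain ⟨a, -, h1, h2⟩ := hosc k
  -- By stationarity the iterate has the same mean as `φ`, so this mean lies in the same short
  -- interval as the iterate.
  have h3 : a ≤ ∫⁻ y, φ y ∂μ := by
    rw [← lintegral_kernelOp_iterate hstat hφ (N * k)]
    calc a = ∫⁻ _, a ∂μ := by simp
      _ ≤ _ := lintegral_mono_ae (hμ.ae_le h1)
  have h4 : ∫⁻ y, φ y ∂μ ≤ a + (1 - ν univ) ^ k := by
    rw [← lintegral_kernelOp_iterate hstat hφ (N * k)]
    calc _ ≤ ∫⁻ _, (a + (1 - ν univ) ^ k) ∂μ := lintegral_mono_ae (hμ.ae_le h2)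
      _ = _ := by simp
  filter_upwards [h1, h2] with x hx1 hx2
  exact ⟨hx2.trans (add_le_add h3 hk.le), h4.trans (add_le_add hx1 hk.le)⟩

/-- Conditioning on the initial point changes survival probabilities by at most
`e + 2 s C Leb B`, where `s` is the time needed to mix up to the error `e`. -/
theorem kernelOp_avoidProb_close [IsMarkovKernel κ] [IsProbabilityMeasure μ]
    (hstat : ∀ φ : M → ℝ≥0∞, Measurable φ → ∫⁻ x, kernelOp κ φ x ∂μ = ∫⁻ x, φ x ∂μ)
    (hμ : μ ≪ Leb) (hac : ∀ᵐ x ∂Leb, κ x ≪ Leb) {C : ℝ≥0∞} (hC : ∀ᵐ x ∂Leb, κ x ≤ C • Leb)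
    {s : ℕ} {e : ℝ≥0∞}
    (hs : ∀ φ : M → ℝ≥0∞, Measurable φ → (φ ≤ fun _ => 1) → ∀ᵐ x ∂Leb,
      (kernelOp κ)^[s] φ x ≤ ∫⁻ y, φ y ∂μ + e ∧ ∫⁻ y, φ y ∂μ ≤ (kernelOp κ)^[s] φ x + e)
    (hB : MeasurableSet B) (m : ℕ) :
    ∀ᵐ x ∂Leb,
      kernelOp κ (avoidProb κ B m) x ≤ ∫⁻ y, avoidProb κ B m y ∂μ + (e + s * (C * Leb B)) ∧
      ∫⁻ y, avoidProb κ B m y ∂μ ≤ kernelOp κ (avoidProb κ B m) x + (e + s * (C * Leb B)) := by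
  have hle1 : ∀ m x, kernelOp κ (avoidProb κ B m) x ≤ 1 := fun m x =>
    (kernelOp_mono κ (avoidProb_le_one κ B _) x).trans
      (le_of_eq (congrFun (kernelOp_iterate_const κ 1 1) x))
  have hint1 : ∀ m, ∫⁻ y, avoidProb κ B m y ∂μ ≤ 1 := fun m =>
    (lintegral_mono (avoidProb_le_one κ B m)).trans (by simp)
  -- short-term visits, from a given point and in the stationary regime
  have hshort : ∀ k l, ∀ᵐ x ∂Leb, (kernelOp κ)^[k + 1] (avoidProb κ B l) x ≤
      kernelOp κ (avoidProb κ B (k + l)) x + k * (C * Leb B) := by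
    intro k l
    have h1 := kernelOp_mono κ (kernelOp_iterate_avoidProb_le κ hB k l)
    rw [← Function.iterate_succ_apply' (kernelOp κ)] at h1
    have h2 : ∀ᵐ x ∂Leb, ∀ i ∈ Finset.range k,
        (kernelOp κ)^[i + 1] (B.indicator 1) x ≤ C * Leb B :=
      (Finset.range k).eventually_all.2 fun i _ => kernelOp_iterate_indicator_le hC hac hB i
    filter_upwards [h2] with x hx
    refine (h1 x).trans ?_
    simp only [kernelOp, Pi.add_apply, Finset.sum_apply]
    rw [lintegral_add_left (measurable_avoidProb κ hB _), lintegral_finsetSum]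
    · gcongr
      calc ∑ i ∈ Finset.range k, ∫⁻ y, (kernelOp κ)^[i] (B.indicator 1) y ∂κ x
          ≤ ∑ i ∈ Finset.range k, C * Leb B := by
            refine Finset.sum_le_sum fun i hi => ?_
            have := hx i hi
            rwa [Function.iterate_succ_apply'] at this
        _ = k * (C * Leb B) := by simp
    · exact fun i _ => measurable_kernelOp_iterate κ (measurable_const.indicator hB) i
  have hshortμ : ∀ k l, ∫⁻ y, avoidProb κ B l y ∂μ ≤
      ∫⁻ y, avoidProb κ B (k + l) y ∂μ + k * (C * Leb B) := by
    intro k l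
    rw [← lintegral_kernelOp_iterate hstat (measurable_avoidProb κ hB l) (k + 1),
      ← hstat _ (measurable_avoidProb κ hB (k + l))]
    calc _ ≤ ∫⁻ x, (kernelOp κ (avoidProb κ B (k + l)) x + k * (C * Leb B)) ∂μ :=
          lintegral_mono_ae (hμ.ae_le (hshort k l))
      _ = _ := by
          rw [lintegral_add_right _ measurable_const]
          simp
  have hanti : ∀ k l, ∫⁻ y, avoidProb κ B (k + l) y ∂μ ≤ ∫⁻ y, avoidProb κ B l y ∂μ := by
    intro k l
    rw [← lintegral_kernelOp_iterate hstat (measurable_avoidProb κ hB l) k]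
    exact lintegral_mono (avoidProb_add_le κ B k l)
  rcases le_total s m with hsm | hms
  -- Leave a gap of `s` steps: ignoring visits in the gap costs `s * (C * Leb B)`, and avoidance
  -- during the remaining `l` steps is then seen after mixing.
  · obtain ⟨l, rfl⟩ := Nat.exists_eq_add_of_le hsm
    have hs' := hs _ (measurable_avoidProb κ hB l) (avoidProb_le_one κ B l)
    have hac' : ∀ᵐ x ∂Leb, ∀ᵐ y ∂κ x,
        (kernelOp κ)^[s] (avoidProb κ B l) y ≤ ∫⁻ y, avoidProb κ B l y ∂μ + e ∧
        ∫⁻ y, avoidProb κ B l y ∂μ ≤ (kernelOp κ)^[s] (avoidProb κ B l) y + e := by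
      filter_upwards [hac] with x hx
      exact hx.ae_le hs'
    filter_upwards [hac', hshort s l] with x hx hx2
    rw [Function.iterate_succ_apply'] at hx2
    constructor
    · calc kernelOp κ (avoidProb κ B (s + l)) x
          ≤ kernelOp κ ((kernelOp κ)^[s] (avoidProb κ B l)) x :=
            kernelOp_mono κ (avoidProb_add_le κ B s l) x
        _ ≤ ∫⁻ _, (∫⁻ y, avoidProb κ B l y ∂μ + e) ∂κ x :=
            lintegral_mono_ae (hx.mono fun y hy => hy.1)
        _ = ∫⁻ y, avoidProb κ B l y ∂μ + e := by simp
        _ ≤ ∫⁻ y, avoidProb κ B (s + l) y ∂μ + s * (C * Leb B) + e := by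
            gcongr; exact hshortμ s l
        _ = _ := by ring
    · calc ∫⁻ y, avoidProb κ B (s + l) y ∂μ ≤ ∫⁻ y, avoidProb κ B l y ∂μ := hanti s l
        _ = ∫⁻ _, (∫⁻ y, avoidProb κ B l y ∂μ) ∂κ x := by simp
        _ ≤ ∫⁻ y, ((kernelOp κ)^[s] (avoidProb κ B l) y + e) ∂κ x :=
            lintegral_mono_ae (hx.mono fun y hy => hy.2)
        _ = kernelOp κ ((kernelOp κ)^[s] (avoidProb κ B l)) x + e := by
            rw [lintegral_add_right _ measurable_const]
            simp [kernelOp]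
        _ ≤ kernelOp κ (avoidProb κ B (s + l)) x + s * (C * Leb B) + e := by gcongr
        _ = _ := by ring
  -- For `m ≤ s` no mixing is needed: both probabilities are within `m * (C * Leb B)` of `1`.
  · have hms' : (m : ℝ≥0∞) ≤ s := by exact_mod_cast hms
    filter_upwards [hshort m 0] with x hx
    constructor
    · calc kernelOp κ (avoidProb κ B m) x ≤ 1 := hle1 m x
        _ = ∫⁻ y, avoidProb κ B 0 y ∂μ := by simp [avoidProb]
        _ ≤ ∫⁻ y, avoidProb κ B m y ∂μ + m * (C * Leb B) := hshortμ m 0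
        _ ≤ ∫⁻ y, avoidProb κ B m y ∂μ + (e + s * (C * Leb B)) := by
            gcongr
            exact le_add_left (by gcongr)
    · calc ∫⁻ y, avoidProb κ B m y ∂μ ≤ 1 := hint1 m
        _ = (kernelOp κ)^[m + 1] (avoidProb κ B 0) x :=
            (congrFun (kernelOp_iterate_const κ 1 (m + 1)) x).symm
        _ ≤ kernelOp κ (avoidProb κ B m) x + m * (C * Leb B) := hx
        _ ≤ kernelOp κ (avoidProb κ B m) x + (e + s * (C * Leb B)) := by
            gcongr
            exact le_add_left (by gcongr)

end TransferOperator

/-! ### From Doeblin kernels to the skew product and path space -/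

section Representation

theorem measurableSet_survivalSet {𝒳 : Type*} [MeasurableSpace 𝒳] {T : 𝒳 → 𝒳} (hT : Measurable T)
    {A : Set 𝒳} (hA : MeasurableSet A) (m : ℕ) : MeasurableSet (survivalSet T A m) := by
  have : survivalSet T A m = ⋂ j ∈ Finset.Icc 1 m, (T^[j] ⁻¹' A)ᶜ := by
    ext z
    simp [survivalSet]
  rw [this]
  exact Finset.measurableSet_biInter _ fun j _ => (hT.iterate j hA).compl

variable {M : Type*} [MeasurableSpace M]

/-- A kernel whose transition probabilities have densities bounded from above and which satisfies
a Doeblin condition, together with an absolutely continuous stationary measure. -/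
structure IsDoeblinKernel (κ : Kernel M M) (Leb μ : Measure M) : Prop where
  stationary : ∀ φ : M → ℝ≥0∞, Measurable φ → ∫⁻ x, kernelOp κ φ x ∂μ = ∫⁻ x, φ x ∂μ
  absolutelyContinuous : μ ≪ Leb
  bounded : ∃ C : ℝ≥0∞, C ≠ ⊤ ∧ ∀ᵐ x ∂Leb, κ x ≤ C • Leb
  minorization : ∃ (N : ℕ) (ν : Measure M), ν univ ≠ 0 ∧ ν univ ≤ 1 ∧ ν ≪ Leb ∧
    ∀ φ : M → ℝ≥0∞, Measurable φ → ∀ᵐ x ∂Leb, ∫⁻ y, φ y ∂ν ≤ (kernelOp κ)^[N] φ x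

variable {κ : Kernel M M} {Leb μ : Measure M}

/-- Testing on indicators gives `μ.bind κ = μ`, which passes to all nonnegative measurable
functions. -/
theorem lintegral_kernelOp_of_isStationaryMeasure [IsMarkovKernel κ] [IsProbabilityMeasure μ]
    (h : IsStationaryMeasure (fun x => κ x) μ) (φ : M → ℝ≥0∞) (hφ : Measurable φ) :
    ∫⁻ x, kernelOp κ φ x ∂μ = ∫⁻ x, φ x ∂μ := by
  have hb : μ.bind κ = μ := by
    ext A hA
    have h1 := h (A.indicator 1) ((integrable_const (1 : ℝ)).indicator hA)
    simp only [integral_indicator_one hA] at h1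
    rw [Measure.bind_apply hA κ.measurable.aemeasurable]
    have h2 : ∫ x, (κ x A).toReal ∂μ = (∫⁻ x, κ x A ∂μ).toReal :=
      integral_toReal (κ.measurable_coe hA).aemeasurable
        (Eventually.of_forall fun x => measure_lt_top _ _)
    have h3 : ∫⁻ x, κ x A ∂μ ≠ ⊤ := by
      refine ne_top_of_le_ne_top ENNReal.one_ne_top ?_
      calc _ ≤ ∫⁻ _, 1 ∂μ := lintegral_mono fun x => prob_le_one
        _ = 1 := by simp
    refine (ENNReal.toReal_eq_toReal_iff' h3 (measure_ne_top _ _)).1 ?_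
    rw [← h2]
    exact h1
  conv_rhs => rw [← hb]
  exact (Measure.lintegral_bind κ.measurable.aemeasurable hφ.aemeasurable).symm

/-- A system whose visits to `V n` are those of a Doeblin chain to small sets `B n` has exponential
hitting and return time statistics. -/
theorem IsDoeblinKernel.hasExponentialHTSRTS [IsMarkovKernel κ] [IsProbabilityMeasure μ]
    (hκ : IsDoeblinKernel κ Leb μ)
    {𝒳 : Type*} [MeasurableSpace 𝒳] {P : Measure 𝒳} [IsProbabilityMeasure P] {T : 𝒳 → 𝒳}
    (hT : Measurable T) {V : ℕ → Set 𝒳} (hV : ∀ n, MeasurableSet (V n)) {B : ℕ → Set M}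
    (hB : ∀ n, MeasurableSet (B n)) (hB0 : ∀ n, μ (B n) ≠ 0)
    (hBlim : Tendsto (fun n => Leb (B n)) atTop (𝓝 0))
    (hsurv : ∀ n m, P (survivalSet T (V n) m) = ∫⁻ x, kernelOp κ (avoidProb κ (B n) m) x ∂μ)
    (hVsurv : ∀ n m, P (V n ∩ survivalSet T (V n) m) =
      ∫⁻ x in B n, kernelOp κ (avoidProb κ (B n) m) x ∂μ) :
    HasExponentialHTSRTS P T V := by
  obtain ⟨C, hCtop, hC⟩ := hκ.bounded
  obtain ⟨N, ν, hν0, hν1, hν, hD⟩ := hκ.minorization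
  have hac : ∀ᵐ x ∂Leb, κ x ≪ Leb :=
    hC.mono fun x hx => (Measure.absolutelyContinuous_of_le_smul hx)
  have hPV : ∀ n, P (V n) = μ (B n) := fun n => by
    have h0 : survivalSet T (V n) 0 = univ := by
      ext z
      simp only [survivalSet, mem_ofPred_eq, mem_univ, iff_true]
      omega
    have := hVsurv n 0
    rw [h0, inter_univ] at this
    simpa [kernelOp, avoidProb] using this
  have hCB : Tendsto (fun n => C * Leb (B n)) atTop (𝓝 0) := by
    simpa using ENNReal.Tendsto.const_mul hBlim (Or.inr hCtop)
  have hrare : IsRareSequence P V := by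
    refine ⟨hV, fun n => ?_, ?_⟩
    · rw [hPV]; exact pos_iff_ne_zero.2 (hB0 n)
    · simp only [hPV]
      exact tendsto_of_tendsto_of_tendsto_of_le_of_le tendsto_const_nhds hCB
        (fun n => zero_le) fun n =>
          measure_le_of_stationary hκ.stationary hκ.absolutelyContinuous hC (hB n)
  -- Stationarity shifts the window from times `1, …, m` to `0, …, m - 1`.
  have hsurv' : ∀ n m, P (survivalSet T (V n) m) = ∫⁻ x, avoidProb κ (B n) m x ∂μ := fun n m => by
    rw [hsurv, hκ.stationary _ (measurable_avoidProb κ (hB n) m)]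
  refine hasExponentialHTSRTS_of_survival hrare
    (fun n m => measurableSet_survivalSet hT (hV n) m) (fun n m => ?_) fun e he => ?_
  · have h1 : P (survivalSet T (V n) m) =
        P (V n ∩ survivalSet T (V n) m) + P (survivalSet T (V n) (m + 1)) := by
      rw [hsurv, hVsurv, hsurv', avoidProb, lintegral_indicator (hB n).compl,
        lintegral_add_compl _ (hB n)]
    rw [measureReal_def, measureReal_def, measureReal_def, h1,
      ENNReal.toReal_add (measure_ne_top _ _) (measure_ne_top _ _)]
    ring
  · have he' : ENNReal.ofReal (e / 2) ≠ 0 := by simpa using he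
    -- Half of the error goes to mixing. This fixes `s` independently of `n`, so short-term visits
    -- eventually fit into the other half.
    obtain ⟨s, hs⟩ := exists_uniform_mixing_of_minorization hκ.stationary
      hκ.absolutelyContinuous hac hν0 hν1 hν hD he'
    have hlim : Tendsto (fun n => (s : ℝ≥0∞) * (C * Leb (B n))) atTop (𝓝 0) := by
      simpa using ENNReal.Tendsto.const_mul hCB (Or.inr (ENNReal.natCast_ne_top s))
    filter_upwards [hlim.eventually (gt_mem_nhds (pos_iff_ne_zero.2 he'))] with n hn m
    set E : ℝ≥0∞ := ENNReal.ofReal (e / 2) + s * (C * Leb (B n)) with hE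
    have hEe : E ≤ ENNReal.ofReal e := by
      calc E ≤ ENNReal.ofReal (e / 2) + ENNReal.ofReal (e / 2) := by rw [hE]; gcongr
        _ = ENNReal.ofReal e := by
          rw [← ENNReal.ofReal_add (by positivity) (by positivity), add_halves]
    have hEtop : E ≠ ⊤ := ne_top_of_le_ne_top ENNReal.ofReal_ne_top hEe
    have hc := hκ.absolutelyContinuous.ae_le (kernelOp_avoidProb_close hκ.stationary
      hκ.absolutelyContinuous hac hC hs (hB n) m)
    have hcB := ae_restrict_of_ae (s := B n) hc
    have u1 : P (V n ∩ survivalSet T (V n) m) ≤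
        P (V n) * P (survivalSet T (V n) m) + E * P (V n) := by
      rw [hVsurv, hsurv', hPV]
      calc _ ≤ ∫⁻ _ in B n, (∫⁻ y, avoidProb κ (B n) m y ∂μ + E) ∂μ :=
            lintegral_mono_ae (hcB.mono fun x hx => hx.1)
        _ = _ := by simp only [lintegral_const, Measure.restrict_apply_univ]; ring
    have u2 : P (V n) * P (survivalSet T (V n) m) ≤
        P (V n ∩ survivalSet T (V n) m) + E * P (V n) := by
      rw [hVsurv, hsurv', hPV]
      calc _ = ∫⁻ _ in B n, (∫⁻ y, avoidProb κ (B n) m y ∂μ) ∂μ := by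
            simp only [lintegral_const, Measure.restrict_apply_univ]; ring
        _ ≤ ∫⁻ x in B n, (kernelOp κ (avoidProb κ (B n) m) x + E) ∂μ :=
            lintegral_mono_ae (hcB.mono fun x hx => hx.2)
        _ = _ := by
          rw [lintegral_add_right _ measurable_const]
          simp only [lintegral_const, Measure.restrict_apply_univ]
    have hEr : E.toReal ≤ e := by
      have := ENNReal.toReal_mono ENNReal.ofReal_ne_top hEe
      rwa [ENNReal.toReal_ofReal he.le] at this
    have t1 := ENNReal.toReal_mono (by finiteness) u1
    have t2 := ENNReal.toReal_mono (by finiteness) u2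
    rw [ENNReal.toReal_add (by finiteness) (by finiteness), ENNReal.toReal_mul,
      ENNReal.toReal_mul] at t1 t2
    have hVn : 0 ≤ (P (V n)).toReal := ENNReal.toReal_nonneg
    have h3 := mul_le_mul_of_nonneg_right hEr hVn
    simp only [measureReal_def]
    rw [abs_le]
    constructor <;> linarith

/-- The head and the tail of an i.i.d. sequence are independent. -/
theorem map_cons_prod_infinitePi {X : Type*} [MeasurableSpace X] (θ : Measure X)
    [IsProbabilityMeasure θ] :
    (θ.prod (Measure.infinitePi fun _ : ℕ => θ)).map
      (fun p n => Nat.casesOn n p.1 p.2 : X × (ℕ → X) → ℕ → X) =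
      Measure.infinitePi fun _ : ℕ => θ := by
  have hmeas : Measurable (fun p n => Nat.casesOn n p.1 p.2 : X × (ℕ → X) → ℕ → X) := by
    refine measurable_pi_lambda _ fun n => ?_
    cases n with
    | zero => exact measurable_fst
    | succ n => exact (measurable_pi_apply n).comp measurable_snd
  refine Measure.eq_infinitePi _ fun s t ht => ?_
  rw [Measure.map_apply hmeas (MeasurableSet.pi s.countable_toSet fun i _ => ht i)]
  set s' : Finset ℕ := s.preimage Nat.succ Nat.succ_injective.injOn with hs'
  have hpre : (fun p n => Nat.casesOn n p.1 p.2 : X × (ℕ → X) → ℕ → X) ⁻¹' ((s : Set ℕ).pi t) =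
      {a | 0 ∈ s → a ∈ t 0} ×ˢ (s' : Set ℕ).pi fun n => t (n + 1) := by
    ext p
    simp only [mem_preimage, Set.mem_pi, mem_prod, mem_ofPred_eq, Finset.mem_coe, hs',
      Finset.mem_preimage]
    constructor
    · exact fun h => ⟨h 0, fun n => h (n + 1)⟩
    · rintro ⟨h1, h2⟩ (_ | n)
      · exact h1
      · exact h2 n
  have hprod : ∏ n ∈ s', θ (t (n + 1)) = ∏ i ∈ s.erase 0, θ (t i) := by
    refine Finset.prod_nbij Nat.succ (fun n hn => ?_) Nat.succ_injective.injOn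
      (fun i hi => ?_) fun n _ => rfl
    · simpa [hs'] using hn
    · simp only [Finset.coe_erase, Set.mem_sdiff, Finset.mem_coe, mem_singleton_iff] at hi
      obtain ⟨n, rfl⟩ := Nat.exists_eq_succ_of_ne_zero hi.2
      exact ⟨n, by simpa [hs'] using hi.1, rfl⟩
  rw [hpre, Measure.prod_prod, Measure.infinitePi_pi _ (fun i _ => ht (i + 1)), hprod]
  by_cases h0 : 0 ∈ s
  · simp only [h0, forall_true_left, ofPred_mem_eq]
    exact Finset.mul_prod_erase s (fun i => θ (t i)) h0
  · simp [h0]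

theorem survivalSet_succ {𝒳 : Type*} (T : 𝒳 → 𝒳) (A : Set 𝒳) (m : ℕ) (z : 𝒳) [MeasurableSpace 𝒳] :
    z ∈ survivalSet T A (m + 1) ↔ T z ∉ A ∧ T z ∈ survivalSet T A m := by
  simp only [survivalSet, mem_ofPred_eq]
  constructor
  · refine fun h => ⟨h 1 le_rfl (by omega), fun j hj1 hj2 => ?_⟩
    rw [← Function.iterate_succ_apply]
    exact h (j + 1) (by omega) (by omega)
  · rintro ⟨h1, h2⟩ j hj1 hj2
    obtain ⟨j, rfl⟩ := Nat.exists_eq_succ_of_ne_zero (by omega : j ≠ 0)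
    rw [Function.iterate_succ_apply]
    rcases Nat.eq_zero_or_pos j with rfl | hj
    · exact h1
    · exact h2 j hj (by omega)

section SkewProduct

variable {X : Type*} [MeasurableSpace X] {F : M → X → M} {θ : Measure X}

theorem measurable_skewProduct (hF : Measurable (Function.uncurry F)) :
    Measurable (skewProduct F) := by
  refine Measurable.prodMk ?_ (measurable_pi_lambda _ fun n => ?_)
  · exact hF.comp (measurable_fst.prodMk ((measurable_pi_apply 0).comp measurable_snd))
  · exact (measurable_pi_apply (n + 1)).comp measurable_snd

/-- The random map seen as a Markov kernel. -/
def transitionKernel (hF : Measurable (Function.uncurry F)) (θ : Measure X) [SFinite θ] :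
    Kernel M M where
  toFun := transition F θ
  measurable' := by
    refine Measure.measurable_of_measurable_coe _ fun A hA => ?_
    have : (fun x => transition F θ x A) =
        fun x => θ (Prod.mk x ⁻¹' (Function.uncurry F ⁻¹' A)) := by
      ext x
      rw [transition, Measure.map_apply hF.of_uncurry_left hA]
      rfl
    rw [this]
    exact measurable_measure_prodMk_left (hF hA)

/-- Induction on `m`, splitting off the first noise coordinate: the remaining noise is independent
of it and has the original law. -/
theorem infinitePi_survivalSet_skewProduct [IsProbabilityMeasure θ]
    (hF : Measurable (Function.uncurry F)) {κ : Kernel M M} (hκ : ∀ x, κ x = transition F θ x)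
    {B : Set M} (hB : MeasurableSet B) (m : ℕ) (x : M) :
    (Measure.infinitePi fun _ : ℕ => θ)
      {η | (x, η) ∈ survivalSet (skewProduct F) (B ×ˢ univ) m} =
      kernelOp κ (avoidProb κ B m) x := by
  have hS : ∀ m, MeasurableSet (survivalSet (skewProduct F) (B ×ˢ (univ : Set (ℕ → X))) m) :=
    measurableSet_survivalSet (measurable_skewProduct hF) (hB.prod MeasurableSet.univ)
  induction m generalizing x with
  | zero =>
    have h0 : {η : ℕ → X | (x, η) ∈ survivalSet (skewProduct F) (B ×ˢ univ) 0} = univ := by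
      ext η
      simp only [survivalSet, mem_ofPred_eq, mem_univ, iff_true]
      omega
    have : IsProbabilityMeasure (κ x) := by
      rw [hκ]
      exact Measure.isProbabilityMeasure_map hF.of_uncurry_left.aemeasurable
    rw [h0, measure_univ]
    simp [kernelOp, avoidProb]
  | succ m ih =>
    have hmeas : Measurable (fun p n => Nat.casesOn n p.1 p.2 : X × (ℕ → X) → ℕ → X) := by
      refine measurable_pi_lambda _ fun n => ?_
      cases n with
      | zero => exact measurable_fst
      | succ n => exact (measurable_pi_apply n).comp measurable_snd
    have hset : MeasurableSet
        {η : ℕ → X | (x, η) ∈ survivalSet (skewProduct F) (B ×ˢ univ) (m + 1)} :=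
      measurable_prodMk_left (hS (m + 1))
    rw [← map_cons_prod_infinitePi θ, Measure.map_apply hmeas hset,
      Measure.prod_apply (hmeas hset)]
    have h1 : ∀ a : X, (Measure.infinitePi fun _ : ℕ => θ) (Prod.mk a ⁻¹'
        ((fun p n => Nat.casesOn n p.1 p.2 : X × (ℕ → X) → ℕ → X) ⁻¹'
          {η | (x, η) ∈ survivalSet (skewProduct F) (B ×ˢ univ) (m + 1)})) =
        avoidProb κ B (m + 1) (F x a) := by
      intro a
      have h2 : (Prod.mk a ⁻¹'
          ((fun p n => Nat.casesOn n p.1 p.2 : X × (ℕ → X) → ℕ → X) ⁻¹'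
            {η | (x, η) ∈ survivalSet (skewProduct F) (B ×ˢ univ) (m + 1)})) =
          {η | F x a ∉ B ∧ (F x a, η) ∈ survivalSet (skewProduct F) (B ×ˢ univ) m} := by
        ext η
        simp only [mem_preimage, mem_ofPred_eq, survivalSet_succ, skewProduct, mem_prod, mem_univ,
          and_true]
        exact Iff.rfl
      rw [h2, avoidProb]
      by_cases hxB : F x a ∈ B
      · simp [hxB]
      · simp only [hxB, not_false_eq_true, true_and, mem_compl_iff, indicator_of_mem]
        exact ih _
    simp only [h1]
    rw [kernelOp, hκ, transition,
      lintegral_map (measurable_avoidProb κ hB (m + 1)) hF.of_uncurry_left]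

theorem annealed_inter_survivalSet [IsProbabilityMeasure θ] [SFinite μ]
    (hF : Measurable (Function.uncurry F)) {κ : Kernel M M} (hκ : ∀ x, κ x = transition F θ x)
    {B D : Set M} (hB : MeasurableSet B) (hD : MeasurableSet D) (m : ℕ) :
    annealed μ θ (D ×ˢ univ ∩ survivalSet (skewProduct F) (B ×ˢ univ) m) =
      ∫⁻ x in D, kernelOp κ (avoidProb κ B m) x ∂μ := by
  have hS : MeasurableSet (survivalSet (skewProduct F) (B ×ˢ (univ : Set (ℕ → X))) m) :=
    measurableSet_survivalSet (measurable_skewProduct hF) (hB.prod MeasurableSet.univ) m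
  rw [annealed, Measure.prod_apply ((hD.prod MeasurableSet.univ).inter hS),
    ← lintegral_indicator hD]
  refine lintegral_congr fun x => ?_
  by_cases hx : x ∈ D
  · rw [indicator_of_mem hx, ← infinitePi_survivalSet_skewProduct hF hκ hB m x]
    congr 1
    ext η
    simp [hx]
  · simp [hx]

theorem IsDoeblinKernel.hasExponentialHTSRTS_skewProduct [IsProbabilityMeasure θ]
    [IsProbabilityMeasure μ] [IsMarkovKernel κ] (hκ : IsDoeblinKernel κ Leb μ)
    (hF : Measurable (Function.uncurry F)) (hκF : ∀ x, κ x = transition F θ x)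
    {B : ℕ → Set M} (hB : ∀ n, MeasurableSet (B n)) (hB0 : ∀ n, μ (B n) ≠ 0)
    (hBlim : Tendsto (fun n => Leb (B n)) atTop (𝓝 0)) :
    HasExponentialHTSRTS (annealed μ θ) (skewProduct F)
      (fun n => B n ×ˢ (univ : Set (ℕ → X))) := by
  have : IsProbabilityMeasure (annealed μ θ) := by unfold annealed; infer_instance
  refine hκ.hasExponentialHTSRTS (measurable_skewProduct hF)
    (fun n => (hB n).prod MeasurableSet.univ) hB hB0 hBlim (fun n m => ?_)
    fun n m => annealed_inter_survivalSet hF hκF (hB n) (hB n) m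
  simpa using annealed_inter_survivalSet (μ := μ) hF hκF (hB n) MeasurableSet.univ m

end SkewProduct

section PathSpace

variable {P : Measure (ℕ → M)}

/-- The defining one-step identity, passed from target sets to functions by identifying the law of
`z (n + 1)` under the restricted path measure. -/
theorem IsMarkovChainLaw.setLIntegral_step (hP : IsMarkovChainLaw (fun x => κ x) μ P)
    {n : ℕ} {A : Set (Fin (n + 1) → M)} (hA : MeasurableSet A) {φ : M → ℝ≥0∞}
    (hφ : Measurable φ) :
    ∫⁻ z in {z | (fun i : Fin (n + 1) => z i) ∈ A}, φ (z (n + 1)) ∂P =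
      ∫⁻ z in {z | (fun i : Fin (n + 1) => z i) ∈ A}, kernelOp κ φ (z n) ∂P := by
  set E : Set (ℕ → M) := {z | (fun i : Fin (n + 1) => z i) ∈ A} with hE
  have hm : Measurable fun z : ℕ → M => κ (z n) := κ.measurable.comp (measurable_pi_apply n)
  have hb : (P.restrict E).map (fun z => z (n + 1)) = (P.restrict E).bind fun z => κ (z n) := by
    ext B hB
    rw [Measure.map_apply (measurable_pi_apply _) hB, Measure.bind_apply hB hm.aemeasurable,
      Measure.restrict_apply (measurable_pi_apply _ hB), ← hP.step n A B hA hB, inter_comm]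
    rfl
  rw [← lintegral_map (f := φ) hφ (measurable_pi_apply (n + 1)), hb,
    Measure.lintegral_bind hm.aemeasurable hφ.aemeasurable]
  rfl

/-- Induction on `l` with `k` free, integrating out future coordinates one at a time by the Markov
property; the application needs `k = 0`. -/
theorem IsMarkovChainLaw.measure_avoid_add (hP : IsMarkovChainLaw (fun x => κ x) μ P)
    [IsMarkovKernel κ] {B D : Set M} (hB : MeasurableSet B) (hD : MeasurableSet D) (l k : ℕ) :
    P {z | z 0 ∈ D ∧ ∀ j, 1 ≤ j → j ≤ k + l → z j ∉ B} =
      ∫⁻ z in {z | z 0 ∈ D ∧ ∀ j, 1 ≤ j → j ≤ k → z j ∉ B},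
        kernelOp κ (avoidProb κ B l) (z k) ∂P := by
  have hcoe : ∀ k : ℕ, {z : ℕ → M | z 0 ∈ D ∧ ∀ j, 1 ≤ j → j ≤ k → z j ∉ B} =
      {z | (fun i : Fin (k + 1) => z i) ∈
        {a : Fin (k + 1) → M | a 0 ∈ D ∧ ∀ j : Fin (k + 1), 1 ≤ (j : ℕ) → a j ∉ B}} := by
    intro k
    ext z
    simp only [mem_ofPred_eq]
    refine and_congr Iff.rfl ⟨fun h j hj => h j hj (by omega), fun h j hj hjk => ?_⟩
    exact h ⟨j, by omega⟩ hj
  have hA : ∀ k : ℕ, MeasurableSet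
      {a : Fin (k + 1) → M | a 0 ∈ D ∧ ∀ j : Fin (k + 1), 1 ≤ (j : ℕ) → a j ∉ B} := by
    intro k
    have : {a : Fin (k + 1) → M | a 0 ∈ D ∧ ∀ j : Fin (k + 1), 1 ≤ (j : ℕ) → a j ∉ B} =
        (fun a => a 0) ⁻¹' D ∩ ⋂ j : Fin (k + 1), ⋂ _ : 1 ≤ (j : ℕ), (fun a => a j) ⁻¹' Bᶜ := by
      ext a
      simp
    rw [this]
    exact (measurable_pi_apply 0 hD).inter (MeasurableSet.iInter fun j => MeasurableSet.iInter
      fun _ => measurable_pi_apply j hB.compl)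
  have hmeasE : ∀ k : ℕ, MeasurableSet {z : ℕ → M | z 0 ∈ D ∧ ∀ j, 1 ≤ j → j ≤ k → z j ∉ B} := by
    intro k
    rw [hcoe]
    exact measurableSet_preimage
      (measurable_pi_lambda _ fun i : Fin (k + 1) => measurable_pi_apply (i : ℕ)) (hA k)
  induction l generalizing k with
  | zero => simp [kernelOp, avoidProb]
  | succ l ih =>
    rw [show k + (l + 1) = (k + 1) + l by ring, ih (k + 1), hcoe k,
      ← hP.setLIntegral_step (hA k) (measurable_avoidProb κ hB (l + 1)), ← hcoe k,
      ← lintegral_indicator (hmeasE _), ← lintegral_indicator (hmeasE _)]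
    refine lintegral_congr fun z => ?_
    by_cases hz : z ∈ {z : ℕ → M | z 0 ∈ D ∧ ∀ j, 1 ≤ j → j ≤ k → z j ∉ B}
    · rw [indicator_of_mem hz, avoidProb]
      by_cases hzB : z (k + 1) ∈ B
      · rw [indicator_of_notMem, indicator_of_notMem (by simpa using hzB)]
        exact fun h => h.2 (k + 1) (by omega) le_rfl hzB
      · rw [indicator_of_mem, indicator_of_mem (by simpa using hzB)]
        refine ⟨hz.1, fun j hj1 hj2 => ?_⟩
        rcases Nat.lt_or_ge k j with h | h
        · rwa [show j = k + 1 by omega]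
        · exact hz.2 j hj1 h
    · rw [indicator_of_notMem hz, indicator_of_notMem]
      exact fun h => hz ⟨h.1, fun j hj1 hj2 => h.2 j hj1 (by omega)⟩

theorem IsDoeblinKernel.hasExponentialHTSRTS_pathShift [IsProbabilityMeasure P]
    [IsProbabilityMeasure μ] [IsMarkovKernel κ] (hκ : IsDoeblinKernel κ Leb μ)
    (hP : IsMarkovChainLaw (fun x => κ x) μ P)
    {B : ℕ → Set M} (hB : ∀ n, MeasurableSet (B n)) (hB0 : ∀ n, μ (B n) ≠ 0)
    (hBlim : Tendsto (fun n => Leb (B n)) atTop (𝓝 0)) :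
    HasExponentialHTSRTS P pathShift (fun n => {z | z 0 ∈ B n}) := by
  have hiter : ∀ (j : ℕ) (z : ℕ → M), pathShift^[j] z = fun n => z (n + j) := by
    intro j
    induction j with
    | zero => intro z; rfl
    | succ j ih =>
      intro z
      rw [Function.iterate_succ_apply, ih]
      ext n
      exact congrArg z (by omega)
  have hrep : ∀ D : Set M, MeasurableSet D → ∀ n m,
      P ({z | z 0 ∈ D} ∩ survivalSet pathShift {z | z 0 ∈ B n} m) =
        ∫⁻ x in D, kernelOp κ (avoidProb κ (B n) m) x ∂μ := by
    intro D hD n m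
    have h1 : {z : ℕ → M | z 0 ∈ D} ∩ survivalSet pathShift {z | z 0 ∈ B n} m =
        {z | z 0 ∈ D ∧ ∀ j, 1 ≤ j → j ≤ 0 + m → z j ∉ B n} := by
      ext z
      simp [survivalSet, hiter]
    have h2 : {z : ℕ → M | z 0 ∈ D ∧ ∀ j, 1 ≤ j → j ≤ 0 → z j ∉ B n} =
        (fun z => z 0) ⁻¹' D := by
      ext z
      simp only [mem_ofPred_eq, mem_preimage, and_iff_left_iff_imp]
      omega
    rw [h1, hP.measure_avoid_add (hB n) hD m 0, h2,
      ← hP.init, setLIntegral_map hD (measurable_kernelOp κ (measurable_avoidProb κ (hB n) m))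
        (measurable_pi_apply 0)]
  refine hκ.hasExponentialHTSRTS (measurable_pi_lambda _ fun n => measurable_pi_apply (n + 1))
    (fun n => measurable_pi_apply 0 (hB n)) hB hB0 hBlim (fun n m => ?_)
    fun n m => hrep (B n) (hB n) n m
  simpa using hrep univ MeasurableSet.univ n m

end PathSpace

end Representation

/-! ### Calculus of minorized transitions between sets -/

section Reachability

variable {M : Type*} [MeasurableSpace M] {κ : Kernel M M} {Leb μ : Measure M}

/-- From almost every point of `U`, the `k`-step transition probabilities dominate a multiple of
the reference measure on `V`. -/
def Reaches (κ : Kernel M M) (Leb : Measure M) (k : ℕ) (U V : Set M) : Prop :=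
  ∃ c : ℝ≥0∞, c ≠ 0 ∧ ∀ φ : M → ℝ≥0∞, Measurable φ →
    ∀ᵐ x ∂Leb, x ∈ U → c * ∫⁻ y in V, φ y ∂Leb ≤ (kernelOp κ)^[k] φ x

theorem reaches_one {U V : Set M} {c : ℝ≥0∞} (hc : c ≠ 0)
    (h : ∀ᵐ x ∂Leb, x ∈ U → c • Leb.restrict V ≤ κ x) : Reaches κ Leb 1 U V := by
  refine ⟨c, hc, fun φ _ => ?_⟩
  filter_upwards [h] with x hx hxU
  rw [← smul_eq_mul, ← lintegral_smul_measure]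
  exact lintegral_mono' (hx hxU) le_rfl

/-- Mass spread over `V` is passed on to `W` from almost every point of `V`. Integrating over `V`
produces the factor `Leb V`, hence the hypothesis that it is nonzero. -/
theorem Reaches.trans {k l : ℕ} {U V W : Set M} (hV0 : Leb V ≠ 0)
    (h₁ : Reaches κ Leb k U V) (h₂ : Reaches κ Leb l V W) : Reaches κ Leb (k + l) U W := by
  obtain ⟨c, hc, h₁⟩ := h₁
  obtain ⟨c', hc', h₂⟩ := h₂
  refine ⟨c * c' * Leb V, mul_ne_zero (mul_ne_zero hc hc') hV0, fun φ hφ => ?_⟩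
  have hint : c' * (∫⁻ y in W, φ y ∂Leb) * Leb V ≤ ∫⁻ y in V, (kernelOp κ)^[l] φ y ∂Leb := by
    rw [← setLIntegral_const]
    exact setLIntegral_mono_ae (measurable_kernelOp_iterate κ hφ l).aemeasurable (h₂ φ hφ)
  filter_upwards [h₁ _ (measurable_kernelOp_iterate κ hφ l)] with x hx hxU
  rw [Function.iterate_add_apply]
  refine le_trans ?_ (hx hxU)
  calc c * c' * Leb V * ∫⁻ y in W, φ y ∂Leb = c * (c' * (∫⁻ y in W, φ y ∂Leb) * Leb V) := by ring
    _ ≤ _ := by gcongr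

theorem reaches_biUnion {ι : Type*} (t : Finset ι) {k : ℕ} {U : ι → Set M} {V : Set M}
    (h : ∀ i ∈ t, Reaches κ Leb k (U i) V) : Reaches κ Leb k (⋃ i ∈ t, U i) V := by
  classical
  induction t using Finset.induction_on with
  | empty => exact ⟨1, one_ne_zero, fun φ _ => by simp⟩
  | insert a t _ ih =>
    obtain ⟨c, hc, h1⟩ := ih fun i hi => h i (Finset.mem_insert_of_mem hi)
    obtain ⟨c', hc', h2⟩ := h a (Finset.mem_insert_self a t)
    refine ⟨min c c', (lt_min (pos_iff_ne_zero.2 hc) (pos_iff_ne_zero.2 hc')).ne',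
      fun φ hφ => ?_⟩
    filter_upwards [h1 φ hφ, h2 φ hφ] with x hx1 hx2 hx
    rw [Finset.set_biUnion_insert] at hx
    rcases hx with hx | hx
    · exact le_trans (by gcongr; exact min_le_right _ _) (hx2 hx)
    · exact le_trans (by gcongr; exact min_le_left _ _) (hx1 hx)

/-- Integrate the lower bound against `μ`; stationarity removes the iterate. -/
theorem Reaches.le_measure [IsProbabilityMeasure μ] {k : ℕ} {V : Set M}
    (h : Reaches κ Leb k univ V) (hμ : μ ≪ Leb)
    (hstat : ∀ φ : M → ℝ≥0∞, Measurable φ → ∫⁻ x, kernelOp κ φ x ∂μ = ∫⁻ x, φ x ∂μ)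
    {A : Set M} (hA : MeasurableSet A) (hpos : Leb (A ∩ V) ≠ 0) : μ A ≠ 0 := by
  obtain ⟨c, hc, h⟩ := h
  have h1 := h (A.indicator 1) (measurable_one.indicator hA)
  rw [lintegral_indicator_one hA, Measure.restrict_apply hA] at h1
  refine ne_of_gt (lt_of_lt_of_le (pos_iff_ne_zero.2 (mul_ne_zero hc hpos)) ?_)
  rw [← lintegral_indicator_one hA,
    ← lintegral_kernelOp_iterate hstat (measurable_one.indicator hA) k]
  calc c * Leb (A ∩ V) = ∫⁻ _, c * Leb (A ∩ V) ∂μ := by simp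
    _ ≤ _ := lintegral_mono_ae (hμ.ae_le (h1.mono fun x hx => hx (mem_univ x)))

theorem Reaches.exists_minorization [IsProbabilityMeasure Leb] {k : ℕ} {V : Set M}
    (h : Reaches κ Leb k univ V) (hV0 : Leb V ≠ 0) :
    ∃ (N : ℕ) (ν : Measure M), ν univ ≠ 0 ∧ ν univ ≤ 1 ∧ ν ≪ Leb ∧
      ∀ φ : M → ℝ≥0∞, Measurable φ → ∀ᵐ x ∂Leb, ∫⁻ y, φ y ∂ν ≤ (kernelOp κ)^[N] φ x := by
  obtain ⟨c, hc, h⟩ := h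
  -- The truncation at `1` keeps the total mass of `ν` at most one.
  refine ⟨k, min c 1 • Leb.restrict V, ?_, ?_, ?_, fun φ hφ => ?_⟩
  · simpa [hV0] using (lt_min (pos_iff_ne_zero.2 hc) one_pos).ne'
  · simp only [Measure.smul_apply, Measure.restrict_apply_univ, smul_eq_mul]
    exact mul_le_one' (min_le_right _ _) prob_le_one
  · exact Measure.AbsolutelyContinuous.smul_left Measure.restrict_le_self.absolutelyContinuous _
  · filter_upwards [h φ hφ] with x hx
    rw [lintegral_smul_measure, smul_eq_mul]
    exact le_trans (by gcongr; exact min_le_left _ _) (hx (mem_univ x))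

end Reachability

/-! ### Doeblin condition along a dense orbit -/

section RandomOrbit

/-- Removing the first `n` orbit points from `U` leaves a nonempty open set, since finite sets are
null and `U` is not. -/
theorem exists_iterate_mem_of_dense {M : Type*} [MetricSpace M] [MeasurableSpace M]
    {Leb : Measure M} {f : M → M} {x₀ : M} [Leb.IsOpenPosMeasure] [NullSingletonClass Leb]
    (hx₀ : Dense (range fun n : ℕ => f^[n] x₀)) {U : Set M} (hU : IsOpen U) (hUne : U.Nonempty)
    (n : ℕ) : ∃ j, n ≤ j ∧ f^[j] x₀ ∈ U := by
  set S : Set M := (fun j => f^[j] x₀) '' Iio n with hS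
  have hfin : S.Finite := (finite_Iio n).image _
  have hne : (U \ S).Nonempty := by
    rw [nonempty_iff_ne_empty]
    intro h
    exact (hU.measure_pos Leb hUne).ne' (measure_mono_null (sdiff_eq_empty.1 h)
      (hfin.measure_zero Leb))
  obtain ⟨_, hp, j, rfl⟩ := hx₀.inter_open_nonempty _ (hU.sdiff hfin.isClosed) hne
  refine ⟨j, ?_, hp.1⟩
  by_contra hj
  exact hp.2 ⟨j, not_le.1 hj, rfl⟩

variable {M : Type*} [MetricSpace M] [CompactSpace M] [ConnectedSpace M] [MeasurableSpace M]
  {κ : Kernel M M} {Leb : Measure M} {f : M → M} {x₀ : M}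

/-- Near a dense orbit of continuity points, a chain whose transition probabilities dominate the
reference measure on balls around the images under `f` satisfies a Doeblin condition. -/
theorem exists_reaches_of_dense_orbit [IsProbabilityMeasure Leb] [Leb.IsOpenPosMeasure]
    [NullSingletonClass Leb] {Y : Set M} (hY : ∀ᵐ x ∂Leb, x ∈ Y) (hfY : ContinuousOn f Y)
    (hx₀ : Dense (range fun n : ℕ => f^[n] x₀)) (hx₀Y : ∀ n : ℕ, f^[n] x₀ ∈ Y)
    {ρ : ℝ} (hρ : 0 < ρ) {c : ℝ≥0∞} (hc : c ≠ 0)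
    (hκ : ∀ᵐ x ∂Leb, c • Leb.restrict (Metric.ball (f x) ρ) ≤ κ x) :
    ∀ U : Set M, IsOpen U → U.Nonempty →
      ∃ (k : ℕ) (V : Set M), Reaches κ Leb k univ V ∧ Leb (U ∩ V) ≠ 0 := by
  set z : ℕ → M := fun n => f^[n] x₀ with hz
  have hzs : ∀ n, f (z n) = z (n + 1) := fun n => (Function.iterate_succ_apply' f n x₀).symm
  have htail : ∀ {U : Set M}, IsOpen U → U.Nonempty → ∀ n, ∃ j, n ≤ j ∧ z j ∈ U :=
    fun hU hne n => exists_iterate_mem_of_dense (Leb := Leb) hx₀ hU hne n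
  have hr : ∀ i, ∃ r : ℝ, 0 < r ∧ r ≤ ρ / 4 ∧
      ∀ y ∈ Metric.ball (z i) r, y ∈ Y → dist (f y) (z (i + 1)) < ρ / 2 := by
    intro i
    obtain ⟨r, hr, h⟩ := Metric.continuousOn_iff.1 hfY (z i) (hx₀Y i) (ρ / 2) (by positivity)
    refine ⟨min r (ρ / 4), lt_min hr (by positivity), min_le_right _ _, fun y hy hyY => ?_⟩
    rw [← hzs]
    exact h y hyY ((Metric.mem_ball.1 hy).trans_le (min_le_left _ _))
  choose r hr0 hr4 hrf using hr
  set W : ℕ → Set M := fun i => Metric.ball (z i) (r i) with hW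
  have hW0 : ∀ i, Leb (W i) ≠ 0 := fun i => (Metric.measure_ball_pos Leb _ (hr0 i)).ne'
  -- one step from a set whose image is near `z j`
  have hone : ∀ (U : Set M) (j : ℕ), (∀ x ∈ U, x ∈ Y → dist (f x) (z j) < ρ * (3 / 4)) →
      Reaches κ Leb 1 U (W j) := by
    intro U j h
    refine reaches_one hc ?_
    filter_upwards [hκ, hY] with x hx hxY hxU
    refine le_trans ?_ hx
    have hsub : W j ⊆ Metric.ball (f x) ρ := by
      intro y hy
      have h1 := h x hxU hxY
      have h2 : dist y (z j) < r j := hy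
      have h3 := dist_triangle y (z j) (f x)
      rw [dist_comm (z j)] at h3
      have h4 := hr4 j
      rw [Metric.mem_ball]
      linarith
    exact Measure.le_iff.2 fun A _ => by
      simp only [Measure.smul_apply, smul_eq_mul]
      gcongr
  -- Continuity costs `ρ / 2` and the shortcut from `z (i + 1)` to `z j` costs `ρ / 4`; the last `ρ
  -- / 4` is the bound on the radius of `W j`.
  have hedge : ∀ i j, dist (z (i + 1)) (z j) < ρ / 4 → Reaches κ Leb 1 (W i) (W j) := by
    refine fun i j hij => hone _ _ fun x hx hxY => ?_
    have h1 := hrf i x hx hxY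
    have h2 := dist_triangle (f x) (z (i + 1)) (z j)
    linarith
  have hfwd : ∀ i k, Reaches κ Leb (k + 1) (W i) (W (i + (k + 1))) := by
    intro i k
    induction k with
    | zero => exact hedge i (i + 1) (by simpa using by positivity)
    | succ k ih =>
      exact ih.trans (hW0 _) (hedge _ _ (by simpa [Nat.add_assoc] using by positivity))
  have hfwd' : ∀ i j, i < j → Reaches κ Leb (j - i) (W i) (W j) := by
    intro i j hij
    obtain ⟨k, rfl⟩ := Nat.exists_eq_add_of_lt hij
    have := hfwd i k
    rwa [show i + k + 1 - i = k + 1 by omega, Nat.add_assoc]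
  have hret : ∀ i, ∃ k, Reaches κ Leb k (W i) (W 0) := by
    intro i
    -- With `i + 2`, even the predecessor of the returning index lies strictly after `i`.
    obtain ⟨j, hj, hjz⟩ := htail (Metric.isOpen_ball (x := z 0) (ε := ρ / 4))
      ⟨z 0, Metric.mem_ball_self (by positivity)⟩ (i + 2)
    obtain ⟨j, rfl⟩ := Nat.exists_eq_succ_of_ne_zero (by omega : j ≠ 0)
    exact ⟨_, (hfwd' i j (by omega)).trans (hW0 _) (hedge j 0 hjz)⟩
  -- aperiodicity
  set L : Set ℕ := {k | Reaches κ Leb k (W 0) (W 0)} with hL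
  -- The given path of length `k` and the orbit path of length `i` close up to loops by the same
  -- return path.
  have hmod : ∀ i k, 0 < i → Reaches κ Leb k (W 0) (W i) → k ≡ i [MOD Nat.setGcd L] := by
    intro i k hi hk
    obtain ⟨l, hl⟩ := hret i
    have h1 : k + l ∈ L := hk.trans (hW0 _) hl
    have h2 : i + l ∈ L := by
      have := (hfwd' 0 i hi).trans (hW0 _) hl
      rwa [Nat.sub_zero] at this
    refine Nat.ModEq.add_right_cancel' l ?_
    exact ((Nat.modEq_zero_iff_dvd.2 (Nat.setGcd_dvd_of_mem h1)).trans
      (Nat.modEq_zero_iff_dvd.2 (Nat.setGcd_dvd_of_mem h2)).symm)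
  -- Follow the orbit to `z (a - 1)`, then jump to `W b` instead of `W a`: `W b` is reached in `a`
  -- steps.
  have hnear : ∀ a b, 2 ≤ a → 1 ≤ b → dist (z a) (z b) < ρ / 4 → a ≡ b [MOD Nat.setGcd L] := by
    intro a b ha hb hab
    obtain ⟨i, rfl⟩ := Nat.exists_eq_succ_of_ne_zero (by omega : a ≠ 0)
    have h1 := (hfwd' 0 i (by omega)).trans (hW0 _) (hedge i b hab)
    simpa using hmod b _ hb h1
  -- Group the `ρ / 8`-balls around orbit points by whether the index is `2` modulo `g`. Overlapping
  -- balls have centres closer than `ρ / 4`, hence congruent indices, so the two unions are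
  -- disjoint; they are open and cover `M`. Connectedness leaves only the class of `2`, so `3 ≡ 2`
  -- modulo `g`.
  have hgcd : Nat.setGcd L = 1 := by
    set g := Nat.setGcd L
    set Q : Set M := ⋃ a ∈ {a : ℕ | 2 ≤ a ∧ a ≡ 2 [MOD g]}, Metric.ball (z a) (ρ / 8) with hQ
    set Q' : Set M := ⋃ a ∈ {a : ℕ | 2 ≤ a ∧ ¬ a ≡ 2 [MOD g]}, Metric.ball (z a) (ρ / 8) with hQ'
    have hQo : IsOpen Q := isOpen_biUnion fun _ _ => Metric.isOpen_ball
    have hQo' : IsOpen Q' := isOpen_biUnion fun _ _ => Metric.isOpen_ball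
    have hcompl : Qᶜ = Q' := by
      ext p
      constructor
      · intro hp
        obtain ⟨a, ha, hap⟩ := htail (Metric.isOpen_ball (x := p) (ε := ρ / 8))
          ⟨p, Metric.mem_ball_self (by positivity)⟩ 2
        have hpa : p ∈ Metric.ball (z a) (ρ / 8) := Metric.mem_ball_comm.1 hap
        refine mem_biUnion (x := a) ⟨ha, fun h => hp ?_⟩ hpa
        exact mem_biUnion (x := a) ⟨ha, h⟩ hpa
      · intro hp hp2
        obtain ⟨a, ha, hpa⟩ := mem_iUnion₂.1 hp
        obtain ⟨b, hb, hpb⟩ := mem_iUnion₂.1 hp2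
        rw [Metric.mem_ball] at hpa hpb
        have h1 := dist_triangle_left (z a) (z b) p
        exact ha.2 ((hnear a b ha.1 (by have := hb.1; omega) (by linarith)).trans hb.2)
    have hQuniv : Q = univ := by
      refine IsClopen.eq_univ ⟨⟨hcompl ▸ hQo'⟩, hQo⟩ ⟨z 2, ?_⟩
      exact mem_biUnion (x := 2) ⟨le_rfl, Nat.ModEq.refl 2⟩ (Metric.mem_ball_self (by positivity))
    have h3 : z 3 ∈ Q := hQuniv ▸ mem_univ _
    obtain ⟨a, ha, hza⟩ := mem_iUnion₂.1 h3
    rw [Metric.mem_ball] at hza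
    have h32 : 3 ≡ 2 [MOD g] :=
      (hnear 3 a (by norm_num) (by have := ha.1; omega) (by linarith)).trans ha.2
    have := (Nat.modEq_iff_dvd' (by norm_num)).1 h32.symm
    simpa using this
  have hLadd : ∀ m ∈ AddSubmonoid.closure L, m = 0 ∨ m ∈ L := by
    intro m hm
    induction hm using AddSubmonoid.closure_induction with
    | mem x hx => exact Or.inr hx
    | zero => exact Or.inl rfl
    | add x y _ _ hx hy =>
      rcases hx with rfl | hx
      · simpa using hy
      · rcases hy with rfl | hy
        · exact Or.inr hx
        · exact Or.inr (Reaches.trans (hW0 0) hx hy)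
  obtain ⟨n₀, hn₀⟩ := Nat.exists_mem_closure_of_ge L
  have hlarge : ∀ i, ∃ N, ∀ m, N ≤ m → Reaches κ Leb m (W i) (W 0) := by
    intro i
    obtain ⟨k, hk⟩ := hret i
    -- The `+ 1` makes `m - k` positive, excluding the zero element of the generated submonoid,
    -- which need not be a loop length.
    refine ⟨k + n₀ + 1, fun m hm => ?_⟩
    have h1 : m - k ∈ L :=
      (hLadd _ (hn₀ (m - k) (by omega) (hgcd ▸ one_dvd _))).resolve_left (by omega)
    have := hk.trans (hW0 _) h1
    rwa [show k + (m - k) = m by omega] at this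
  choose N hN using hlarge
  -- a finite part of the orbit is sufficiently dense
  obtain ⟨t, ht⟩ := isCompact_univ.elim_finite_subcover (fun i => Metric.ball (z i) (ρ / 2))
    (fun i => Metric.isOpen_ball) (fun p _ => by
      obtain ⟨j, -, hj⟩ := htail (Metric.isOpen_ball (x := p) (ε := ρ / 2))
        ⟨p, Metric.mem_ball_self (by positivity)⟩ 0
      exact mem_iUnion.2 ⟨j, Metric.mem_ball_comm.1 hj⟩)
  -- Sort points by which `z i` their image under `f` is close to, step into `W i`, then spend
  -- exactly `t.sup N` steps reaching `W 0`; the common length permits the union.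
  have hall : Reaches κ Leb (1 + t.sup N) univ (W 0) := by
    have h1 := reaches_biUnion (κ := κ) (Leb := Leb) t (k := 1 + t.sup N)
      (U := fun i => f ⁻¹' Metric.ball (z i) (ρ / 2)) (V := W 0) fun i hi =>
        (hone _ i fun x hx _ => by
          have : dist (f x) (z i) < ρ / 2 := hx
          linarith).trans (hW0 _) (hN i _ (Finset.le_sup hi))
    have h2 : ⋃ i ∈ t, f ⁻¹' Metric.ball (z i) (ρ / 2) = univ := by
      refine eq_univ_of_forall fun x => ?_
      obtain ⟨i, hi, hx⟩ := mem_iUnion₂.1 (ht (mem_univ (f x)))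
      exact mem_biUnion hi hx
    rwa [h2] at h1
  intro U hU hUne
  obtain ⟨j, hj, hjU⟩ := htail hU hUne 1
  refine ⟨_, W j, hall.trans (hW0 _) (hfwd' 0 j hj), ?_⟩
  exact ((hU.inter Metric.isOpen_ball).measure_pos Leb
    ⟨z j, hjU, Metric.mem_ball_self (hr0 j)⟩).ne'

end RandomOrbit

/-! ### Positivity on open sets and absence of atoms for smooth volumes -/

section SmoothVolume

variable {d : ℕ} {M : Type*} [TopologicalSpace M] [MeasurableSpace M] [BorelSpace M]
  [ChartedSpace (EuclideanSpace ℝ (Fin d)) M] {Leb : Measure M}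

theorem IsSmoothVolume.isOpenPosMeasure (h : IsSmoothVolume d Leb) : Leb.IsOpenPosMeasure := by
  refine ⟨fun U hU ⟨x, hx⟩ h0 => ?_⟩
  set e := chartAt (EuclideanSpace ℝ (Fin d)) x with he
  obtain ⟨ρ, hρ, hρpos, hLeb⟩ := h e (chart_mem_atlas _ x)
  have hopen : IsOpen (U ∩ e.source) := hU.inter e.open_source
  have hsub : e '' (U ∩ e.source) ⊆ e.target :=
    (image_mono inter_subset_right).trans e.image_source_eq_target.subset
  have himg : IsOpen (e '' (U ∩ e.source)) :=
    e.isOpen_image_of_subset_source hopen inter_subset_right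
  have h1 := hLeb _ hopen.measurableSet inter_subset_right
  rw [measure_mono_null inter_subset_left h0] at h1
  have haem : AEMeasurable (fun y => ENNReal.ofReal (ρ y))
      (volume.restrict (e '' (U ∩ e.source))) :=
    ((hρ.continuousOn.mono hsub).aemeasurable himg.measurableSet).ennreal_ofReal
  have h2 := (ae_restrict_iff' himg.measurableSet).1 ((lintegral_eq_zero_iff' haem).1 h1.symm)
  have h3 : volume (e '' (U ∩ e.source)) = 0 := by
    refine measure_mono_null (fun y hy => ?_) h2
    simp only [mem_compl_iff, mem_ofPred_eq, Pi.zero_apply, ENNReal.ofReal_eq_zero, not_forall,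
      not_le]
    exact ⟨hy, hρpos y (hsub hy)⟩
  exact (himg.measure_pos volume ⟨e x, x, ⟨hx, mem_chart_source _ x⟩, rfl⟩).ne' h3

theorem IsSmoothVolume.nullSingletonClass [T1Space M] (h : IsSmoothVolume d Leb) (hd : 0 < d) :
    NullSingletonClass Leb := by
  have : Nonempty (Fin d) := ⟨⟨0, hd⟩⟩
  refine ⟨fun x => ?_⟩
  obtain ⟨ρ, -, -, hLeb⟩ := h _ (chart_mem_atlas (EuclideanSpace ℝ (Fin d)) x)
  rw [hLeb {x} (measurableSet_singleton x) (singleton_subset_iff.2 (mem_chart_source _ x)),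
    image_singleton]
  exact setLIntegral_measure_zero _ _ (measure_singleton _)

end SmoothVolume

/-! ### Both perturbation schemes give Doeblin kernels -/

section Perturbations

variable {M : Type*} [MetricSpace M] [MeasurableSpace M] [BorelSpace M] {Leb μ : Measure M}

theorem tendsto_measure_ball_zero [IsFiniteMeasure Leb] [NullSingletonClass Leb] (ζ : M)
    {δ : ℕ → ℝ} (hδ_pos : ∀ n, 0 < δ n) (hδ : Tendsto δ atTop (𝓝 0)) :
    Tendsto (fun n => Leb (Metric.ball ζ (δ n))) atTop (𝓝 0) := by
  have h1 := tendsto_measure_biInter_gt (μ := Leb) (s := fun r : ℝ => Metric.ball ζ r) (a := 0)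
    (fun r _ => Metric.isOpen_ball.measurableSet.nullMeasurableSet)
    (fun i j _ hij => Metric.ball_subset_ball hij) ⟨1, one_pos, measure_ne_top _ _⟩
  have h2 : ⋂ r : ℝ, ⋂ _ : r > 0, Metric.ball ζ r = {ζ} := by
    ext x
    simp only [mem_iInter, Metric.mem_ball, mem_singleton_iff]
    constructor
    · exact fun h => dist_le_zero.1 (le_of_forall_pos_le_add fun e he => by
        simpa using (h e he).le)
    · rintro rfl r hr
      simpa using hr
  rw [h2, measure_singleton] at h1
  exact h1.comp (tendsto_nhdsWithin_iff.2 ⟨hδ, Eventually.of_forall hδ_pos⟩)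

/-- The measure `μ` is the `μ`-average of the `κ x`, almost all of which vanish on `Leb`-null sets.
-/
theorem absolutelyContinuous_of_stationary {M : Type*} [MeasurableSpace M] {Leb μ : Measure M}
    {κ : Kernel M M}
    (hstat : ∀ φ : M → ℝ≥0∞, Measurable φ → ∫⁻ x, kernelOp κ φ x ∂μ = ∫⁻ x, φ x ∂μ)
    (hac : ∀ᵐ x ∂μ, κ x ≪ Leb) : μ ≪ Leb := by
  refine Measure.AbsolutelyContinuous.mk fun A hA h0 => ?_
  rw [← lintegral_indicator_one hA, ← hstat _ (measurable_one.indicator hA)]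
  rw [lintegral_congr_ae (g := fun _ => 0), lintegral_zero]
  filter_upwards [hac] with x hx
  simp only [kernelOp, lintegral_indicator_one hA, hx h0]

/-- The transition kernel of a uniform random perturbation of a map with a dense orbit of
continuity points satisfies a Doeblin condition. -/
theorem IsUniformRandomPerturbation.isDoeblinKernel [CompactSpace M] [ConnectedSpace M]
    [IsProbabilityMeasure Leb] [Leb.IsOpenPosMeasure] [NullSingletonClass Leb]
    [IsProbabilityMeasure μ] {f : M → M} {Y : Set M} (hY : ∀ᵐ x ∂Leb, x ∈ Y)
    (hfY : ContinuousOn f Y) {x₀ : M} (hx₀ : Dense (range fun n : ℕ => f^[n] x₀))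
    (hx₀Y : ∀ n : ℕ, f^[n] x₀ ∈ Y) {X : Type*} [MetricSpace X] [MeasurableSpace X]
    {θ : Measure X} {F : M → X → M} (h : IsUniformRandomPerturbation Leb f F θ)
    {κ : Kernel M M} [IsMarkovKernel κ] (hκ : ∀ x, κ x = transition F θ x)
    (hstat : ∀ φ : M → ℝ≥0∞, Measurable φ → ∫⁻ x, kernelOp κ φ x ∂μ = ∫⁻ x, φ x ∂μ)
    (hac : ∀ᵐ x ∂μ, κ x ≪ Leb) :
    IsDoeblinKernel κ Leb μ ∧ ∀ U : Set M, IsOpen U → U.Nonempty → μ U ≠ 0 := by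
  have : SecondCountableTopology M := UniformSpace.secondCountable_of_separable M
  obtain ⟨-, ⟨ρ, hρ, hball⟩, qlo, qhi, hqlo, -, hq⟩ := h
  simp only [← hκ] at hball hq
  have hμ := absolutelyContinuous_of_stationary hstat hac
  have hlow : ∀ᵐ x ∂Leb, (qlo : ℝ≥0∞) • Leb.restrict (Metric.ball (f x) ρ) ≤ κ x := by
    filter_upwards [hball, hq] with x hx ⟨q, _, hqκ, hqb⟩
    refine Measure.le_iff.2 fun A hA => ?_
    have hAB : MeasurableSet (A ∩ Metric.ball (f x) ρ) :=
      hA.inter Metric.isOpen_ball.measurableSet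
    simp only [Measure.smul_apply, smul_eq_mul, Measure.restrict_apply hA]
    calc qlo * Leb (A ∩ Metric.ball (f x) ρ)
        = ∫⁻ _ in A ∩ Metric.ball (f x) ρ, qlo ∂Leb := (setLIntegral_const _ _).symm
      _ ≤ ∫⁻ y in A ∩ Metric.ball (f x) ρ, q y ∂Leb := by
          refine setLIntegral_mono_ae' hAB ?_
          filter_upwards [hqb] with y hy hyA
          exact_mod_cast (hy (hx hyA.2)).1
      _ ≤ ∫⁻ y in A, q y ∂Leb := lintegral_mono_set inter_subset_left
      _ = κ x A := by
          conv_rhs => rw [hqκ]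
          rw [withDensity_apply _ hA]
  have hupp : ∀ᵐ x ∂Leb, κ x ≤ (qhi : ℝ≥0∞) • Leb := by
    filter_upwards [hq] with x ⟨q, _, hqκ, hqb⟩
    refine Measure.le_iff.2 fun A hA => ?_
    have hAS : MeasurableSet (A ∩ (κ x).support) :=
      hA.inter Measure.isClosed_support.measurableSet
    simp only [Measure.smul_apply, smul_eq_mul]
    -- The density is bounded only on the support, but `κ x` gives no mass to the complement of its
    -- support.
    calc κ x A = κ x (A ∩ (κ x).support) :=
          (measure_inter_conull (Measure.measure_compl_support (μ := κ x))).symm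
      _ = ∫⁻ y in A ∩ (κ x).support, q y ∂Leb := by
          rw [← withDensity_apply _ hAS, ← hqκ]
      _ ≤ ∫⁻ _ in A ∩ (κ x).support, qhi ∂Leb := by
          refine setLIntegral_mono_ae' hAS ?_
          filter_upwards [hqb] with y hy hyA
          exact_mod_cast (hy hyA.2).2
      _ = qhi * Leb (A ∩ (κ x).support) := setLIntegral_const _ _
      _ ≤ qhi * Leb A := by gcongr; exact inter_subset_left
  have hreach := exists_reaches_of_dense_orbit hY hfY hx₀ hx₀Y hρ
    (by exact_mod_cast hqlo.ne') hlow
  refine ⟨⟨hstat, hμ, ⟨qhi, ENNReal.coe_ne_top, hupp⟩, ?_⟩, fun U hU hUne => ?_⟩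
  · obtain ⟨k, V, hV, hV0⟩ := hreach univ isOpen_univ ⟨x₀, mem_univ _⟩
    rw [univ_inter] at hV0
    exact hV.exists_minorization hV0
  · obtain ⟨k, V, hV, hV0⟩ := hreach U hU hUne
    exact hV.le_measure hμ hstat hU.measurableSet hV0

/-- A Markov chain with positive densities depending continuously on the initial point, as a
kernel. -/
def densityMarkovKernel [CompactSpace M] (Leb : Measure M) [SFinite Leb] {q : M → C(M, ℝ)}
    (hq : Continuous q) : Kernel M M where
  toFun := densityKernel Leb q
  measurable' := by
    have : SecondCountableTopology M := UniformSpace.secondCountable_of_separable M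
    refine Measure.measurable_of_measurable_coe _ fun A hA => ?_
    have hcont : Continuous fun p : M × M => q p.1 p.2 :=
      (hq.comp continuous_fst).eval continuous_snd
    simp only [densityKernel, withDensity_apply _ hA]
    exact hcont.measurable.ennreal_ofReal.lintegral_prod_right'

/-- Since `q` is jointly continuous and positive on the compact space `M × M`, its minimum is
positive and its maximum finite. Thus one step minorizes from every point onto all of `M`. -/
theorem IsRegularMarkovPerturbation.isDoeblinKernel [CompactSpace M] [Nonempty M]
    [IsProbabilityMeasure Leb] [Leb.IsOpenPosMeasure] [IsProbabilityMeasure μ]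
    {f : M → M} {Y : Set M} {q : M → C(M, ℝ)} (h : IsRegularMarkovPerturbation Leb f Y q)
    {κ : Kernel M M} [IsMarkovKernel κ] (hκ : ∀ x, κ x = densityKernel Leb q x)
    (hstat : ∀ φ : M → ℝ≥0∞, Measurable φ → ∫⁻ x, kernelOp κ φ x ∂μ = ∫⁻ x, φ x ∂μ) :
    IsDoeblinKernel κ Leb μ ∧ ∀ U : Set M, IsOpen U → U.Nonempty → μ U ≠ 0 := by
  have hcont : Continuous fun p : M × M => q p.1 p.2 :=
    (h.continuous.comp continuous_fst).eval continuous_snd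
  obtain ⟨p, -, hp⟩ := isCompact_univ.exists_isMinOn (univ_nonempty (α := M × M)) hcont.continuousOn
  obtain ⟨p', -, hp'⟩ :=
    isCompact_univ.exists_isMaxOn (univ_nonempty (α := M × M)) hcont.continuousOn
  have hmin : ∀ x y, q p.1 p.2 ≤ q x y := fun x y => hp (mem_univ (x, y))
  have hmax : ∀ x y, q x y ≤ q p'.1 p'.2 := fun x y => hp' (mem_univ (x, y))
  have hupp : ∀ x, κ x ≤ ENNReal.ofReal (q p'.1 p'.2) • Leb := fun x => by
    rw [hκ, densityKernel, ← withDensity_const]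
    exact withDensity_mono (Eventually.of_forall fun y => ENNReal.ofReal_le_ofReal (hmax x y))
  have hlow : ∀ x, ENNReal.ofReal (q p.1 p.2) • Leb ≤ κ x := fun x => by
    rw [hκ, densityKernel, ← withDensity_const]
    exact withDensity_mono (Eventually.of_forall fun y => ENNReal.ofReal_le_ofReal (hmin x y))
  have hμ : μ ≪ Leb := absolutelyContinuous_of_stationary hstat
    (Eventually.of_forall fun x => Measure.absolutelyContinuous_of_le_smul (hupp x))
  have hreach : Reaches κ Leb 1 univ univ :=
    reaches_one (c := ENNReal.ofReal (q p.1 p.2)) (by simpa using h.pos p.1 p.2)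
      (Eventually.of_forall fun x _ => by simpa using hlow x)
  refine ⟨⟨hstat, hμ, ⟨_, ENNReal.ofReal_ne_top, Eventually.of_forall hupp⟩,
    hreach.exists_minorization (by simp)⟩, fun U hU hUne => ?_⟩
  exact hreach.le_measure hμ hstat hU.measurableSet
    (by simpa using (hU.measure_pos Leb hUne).ne')

end Perturbations

end

theorem corollaryD
    (d : ℕ) (hd : 0 < d)
    {M : Type u} [MetricSpace M] [CompactSpace M] [ConnectedSpace M]
    [MeasurableSpace M] [BorelSpace M]
    [ChartedSpace (EuclideanSpace ℝ (Fin d)) M] [IsManifold (𝓡 d) ∞ M]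
    [RiemannianBundle (fun x : M => TangentSpace (𝓡 d) x)]
    [IsContMDiffRiemannianBundle (𝓡 d) ∞ (EuclideanSpace ℝ (Fin d))
      (fun x : M => TangentSpace (𝓡 d) x)]
    [IsRiemannianManifold (𝓡 d) M]
    (Leb : Measure M) [IsProbabilityMeasure Leb] (hLeb : IsSmoothVolume d Leb)
    (f : M → M) (hf : Measurable f)
    (Y : Set M) (hY : ∀ᵐ x ∂Leb, x ∈ Y) (hfY : ContinuousOn f Y)
    (x₀ : M) (hx₀_dense : Dense (Set.range fun n : ℕ => f^[n] x₀))
    (hx₀_mem : ∀ n : ℕ, f^[n] x₀ ∈ Y)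
    (μ : Measure M) [IsProbabilityMeasure μ]
    (ζ : M) (δ : ℕ → ℝ) (hδ_pos : ∀ n, 0 < δ n) (hδ : Tendsto δ atTop (𝓝 0)) :
    -- random maps scheme
    (∀ (X : Type v) [MetricSpace X] [CompactSpace X] [MeasurableSpace X] [BorelSpace X]
        (θ : Measure X) [IsProbabilityMeasure θ] (F : M → X → M),
      Measurable (Function.uncurry F) →
      IsUniformRandomPerturbation Leb f F θ →
      IsStationaryMeasure (transition F θ) μ →
      (∀ᵐ x ∂μ, transition F θ x ≪ Leb) →
      HasExponentialHTSRTS (annealed μ θ) (skewProduct F)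
        (fun n => Metric.ball ζ (δ n) ×ˢ (Set.univ : Set (ℕ → X)))) ∧
    -- Markov chain, in any representation by random maps and on its path space
    (∀ q : M → C(M, ℝ),
      IsRegularMarkovPerturbation Leb f Y q →
      IsStationaryMeasure (densityKernel Leb q) μ →
      (∀ (X : Type w) [MeasurableSpace X] (θ : Measure X) [IsProbabilityMeasure θ]
          (F : M → X → M),
        Measurable (Function.uncurry F) →
        (∀ x, transition F θ x = densityKernel Leb q x) →
        HasExponentialHTSRTS (annealed μ θ) (skewProduct F)
          (fun n => Metric.ball ζ (δ n) ×ˢ (Set.univ : Set (ℕ → X)))) ∧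
      (∀ (P : Measure (ℕ → M)) [IsProbabilityMeasure P],
        IsMarkovChainLaw (densityKernel Leb q) μ P →
        HasExponentialHTSRTS P pathShift
          (fun n => {z | z 0 ∈ Metric.ball ζ (δ n)}))) := by

  have := hLeb.isOpenPosMeasure
  have := hLeb.nullSingletonClass hd
  have hne : Nonempty M := ⟨x₀⟩
  have hB : ∀ n, MeasurableSet (Metric.ball ζ (δ n)) := fun n => Metric.isOpen_ball.measurableSet
  have hBne : ∀ n, (Metric.ball ζ (δ n)).Nonempty := fun n => ⟨ζ, Metric.mem_ball_self (hδ_pos n)⟩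
  have hBlim := tendsto_measure_ball_zero (Leb := Leb) ζ hδ_pos hδ
  refine ⟨?_, fun q hq hstat => ?_⟩
  · intro X _ _ _ _ θ _ F hF hpert hstat hac
    have : IsMarkovKernel (transitionKernel hF θ) :=
      ⟨fun x => Measure.isProbabilityMeasure_map hF.of_uncurry_left.aemeasurable⟩
    obtain ⟨hD, hpos⟩ := hpert.isDoeblinKernel (μ := μ) hY hfY hx₀_dense hx₀_mem
      (κ := transitionKernel hF θ) (fun _ => rfl)
      (lintegral_kernelOp_of_isStationaryMeasure hstat) hac
    exact hD.hasExponentialHTSRTS_skewProduct hF (fun _ => rfl) hB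
      (fun n => hpos _ Metric.isOpen_ball (hBne n)) hBlim
  · have : IsMarkovKernel (densityMarkovKernel Leb hq.continuous) := ⟨hq.isProbability⟩
    obtain ⟨hD, hpos⟩ := hq.isDoeblinKernel (μ := μ)
      (κ := densityMarkovKernel Leb hq.continuous) (fun _ => rfl)
      (lintegral_kernelOp_of_isStationaryMeasure hstat)
    have hB0 : ∀ n, μ (Metric.ball ζ (δ n)) ≠ 0 :=
      fun n => hpos _ Metric.isOpen_ball (hBne n)
    refine ⟨fun X _ θ _ F hF hFq => ?_, fun P _ hP => ?_⟩
    · exact hD.hasExponentialHTSRTS_skewProduct hF (fun x => (hFq x).symm) hB hB0 hBlim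
    · exact hD.hasExponentialHTSRTS_pathShift hP hB hB0 hBlim
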